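/- Let $d$ be a real number with $0<d<n$, and write $B(x,r)$ for open balls of $\mathbb R^n$ and $\delta_{\partial\Omega}=\operatorname{dist}(\cdot,\partial\Omega)$. A domain (nonempty connected open set) $\Omega\subset\mathbb R^n$ is called *uniform with constants* $(\epsilon,N)$, where $\epsilon\in(0,1)$ and $N\in\mathbb N$, if - (corkscrew points) for all $x\in\partial\Omega$ and $0<r<\operatorname{diam}\Omega$ there is $X\in\Omega\cap B(x,r)$ with $B(X,\epsilon r)\subset\Omega$; - (Harnack chains) for all $X,Y\in\Omega$ with $|X-Y|/\min\{\delta_{\partial\Omega}(X),\delta_{\partial\Omega}(Y)\}\le 10/\epsilon$ there are points $Z_0=X,Z_1,\dots,Z_N=Y$ with $|Z_i-Z_{i+1}|\le\delta_{\partial\Omega}(Z_i)/2$ for $0\le i<N$. A Borel measure $\sigma$ on $\mathbb R^n$ with $\sigma(\mathbb R^n\setminus E)=0$ is a *$d$-Ahlfors regular measure on $E$ with constant* $C>0$ if $C^{-1}r^d\le\sigma(B(x,r))\le Cr^d$ for all $x\in E$ and $0<r<\operatorname{diam}E$. The local Hausdorff distance is $$d_{x,r}(E,F):=\frac1r\sup\{\operatorname{dist}(y,F):y\in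 E\cap B(x,r)\}+\frac1r\sup\{\operatorname{dist}(y,E):y\in F\cap B(x,r)\},$$ with $\sup\emptyset=0$. Let $\{\Omega_j\}_{j\ge0}$ be domains in $\mathbb R^n$ and $\{\sigma_j\}_{j\ge 0}$ Borel measures on $\mathbb R^n$ such that, for constants $\epsilon, N, C$ independent of $j$, 1. $\Omega_j$ is uniform with constants $(\epsilon,N)$; 2. $\sigma_j$ is a $d$-Ahlfors regular measure on $\partial\Omega_j$ with constant $C$; 3. $\operatorname{diam}\partial\Omega_j\ge2^j$; 4. $0\in\partial\Omega_j$. Then there are a subsequence (still denoted by the index $j$), a domain $\Omega_\infty\subset\mathbb R^n$ and a Borel measure $\sigma_\infty$ on $\mathbb R^n$ such that: - for all $x\in\mathbb R^n$ and $r>0$, $\lim_{j\to\infty}d_{x,r}(\Omega_j,\Omega_\infty)=0$ and $\lim_{j\to\infty}d_{x,r}(\partial\Omega_j,\partial\Omega_\infty)=0$; - $\Omega_\infty$ is uniform with constants $(\epsilon/4,10N)$; - $\sigma_j$ converges weakly to $\sigma_\infty$, that is, $\int f\,d\sigma_j\to\int f\,d\sigma_\infty$ for every continuous compactly supported $f:\mathbb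 R^n\to\mathbb R$; - $\sigma_\infty$ is a $d$-Ahlfors regular measure on $\partial\Omega_\infty$ (with some constant), and its support is unbounded and equal to $\partial\Omega_\infty$; - for every $\beta>0$, the smooth distances $$D_{\beta,j}(X):=\Big(\int_{\partial\Omega_j}|X-y|^{-d-\beta}\,d\sigma_j(y)\Big)^{-1/\beta}\ \ (X\in\mathbb R^n\setminus\partial\Omega_j),\qquad D_{\beta,j}(X):=0\ \ (X\in\partial\Omega_j),\qquad j\in\mathbb N\cup\{\infty\},$$ converge uniformly to $D_{\beta,\infty}$ on every compact subset of $\mathbb R^n$ as $j\to\infty$ along the subsequence. -/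

import Mathlib

open Filter Topology MeasureTheory

/-- A domain of `ℝⁿ`: a nonempty connected open set. -/
def IsDomainSet {n : ℕ} (Ω : Set (EuclideanSpace ℝ (Fin n))) : Prop :=
  IsOpen Ω ∧ IsConnected Ω

/-- The corkscrew point condition with constant `ε`. The diameter is taken in `[0, ∞]`. -/
def CorkscrewCondition {n : ℕ} (Ω : Set (EuclideanSpace ℝ (Fin n))) (ε : ℝ) : Prop :=
  ∀ x ∈ frontier Ω, ∀ r : ℝ, 0 < r → ENNReal.ofReal r < Metric.ediam Ω →
    ∃ X ∈ Ω ∩ Metric.ball x r, Metric.ball X (ε * r) ⊆ Ω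

/-- The Harnack chain condition with constants `(ε, N)`: two points `X, Y` of `Ω` that satisfy
`|X - Y| / min (δ X) (δ Y) ≤ 10 / ε`, where `δ` is the distance to the boundary, are joined by a
chain `Z 0, …, Z N` of `N + 1` points with `|Z i - Z (i + 1)| ≤ δ (Z i) / 2`. -/
def HarnackChainCondition {n : ℕ} (Ω : Set (EuclideanSpace ℝ (Fin n))) (ε : ℝ) (N : ℕ) : Prop :=
  ∀ X ∈ Ω, ∀ Y ∈ Ω,
    dist X Y / min (Metric.infDist X (frontier Ω)) (Metric.infDist Y (frontier Ω)) ≤ 10 / ε →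
    ∃ Z : ℕ → EuclideanSpace ℝ (Fin n), Z 0 = X ∧ Z N = Y ∧
      ∀ i < N, dist (Z i) (Z (i + 1)) ≤ Metric.infDist (Z i) (frontier Ω) / 2

/-- `Ω` is a uniform domain with constants `(ε, N)`. -/
structure IsUniformDomain {n : ℕ} (Ω : Set (EuclideanSpace ℝ (Fin n))) (ε : ℝ) (N : ℕ) :
    Prop where
  isDomain : IsDomainSet Ω
  eps_pos : 0 < ε
  eps_lt_one : ε < 1
  corkscrew : CorkscrewCondition Ω ε
  harnack : HarnackChainCondition Ω ε N

/-- `σ` is a `d`-Ahlfors regular measure on `E` with constant `C`: it is supported on `E` and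
`C⁻¹ r ^ d ≤ σ (B(x, r)) ≤ C r ^ d` for `x ∈ E` and `0 < r < diam E` (diameter in `[0, ∞]`). -/
structure IsAhlforsRegular {n : ℕ} (d C : ℝ) (E : Set (EuclideanSpace ℝ (Fin n)))
    (σ : Measure (EuclideanSpace ℝ (Fin n))) : Prop where
  const_pos : 0 < C
  supported : σ Eᶜ = 0
  lower : ∀ x ∈ E, ∀ r : ℝ, 0 < r → ENNReal.ofReal r < Metric.ediam E →
    ENNReal.ofReal (C⁻¹ * r ^ d) ≤ σ (Metric.ball x r)
  upper : ∀ x ∈ E, ∀ r : ℝ, 0 < r → ENNReal.ofReal r < Metric.ediam E →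
    σ (Metric.ball x r) ≤ ENNReal.ofReal (C * r ^ d)

/-- The local Hausdorff distance `d_{x,r}(E, F)` (for nonempty `E` and `F`, where both suprema
are of sets that are bounded above; a supremum over the empty set is `0`). -/
noncomputable def localHausdorffDist {n : ℕ} (x : EuclideanSpace ℝ (Fin n)) (r : ℝ)
    (E F : Set (EuclideanSpace ℝ (Fin n))) : ℝ :=
  1 / r * sSup ((fun y => Metric.infDist y F) '' (E ∩ Metric.ball x r)) +
    1 / r * sSup ((fun y => Metric.infDist y E) '' (F ∩ Metric.ball x r))

/-- Weak convergence of (locally finite) measures on `ℝⁿ`: convergence of the integrals of all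
continuous functions with compact support. -/
def WeaklyConverges {n : ℕ} (μ : ℕ → Measure (EuclideanSpace ℝ (Fin n)))
    (ν : Measure (EuclideanSpace ℝ (Fin n))) : Prop :=
  ∀ f : EuclideanSpace ℝ (Fin n) → ℝ, Continuous f → HasCompactSupport f →
    Tendsto (fun j => ∫ x, f x ∂(μ j)) atTop (𝓝 (∫ x, f x ∂ν))

open Classical in
/-- The smooth distance `D_β` of the domain `Ω` for the measure `σ` on its boundary, extended by
`0` to the boundary. (The integral is finite and positive off the boundary when `σ` is
`d`-Ahlfors regular on `∂Ω` and `d, β > 0`.) -/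
noncomputable def smoothDist {n : ℕ} (d β : ℝ) (Ω : Set (EuclideanSpace ℝ (Fin n)))
    (σ : Measure (EuclideanSpace ℝ (Fin n))) (X : EuclideanSpace ℝ (Fin n)) : ℝ :=
  if X ∈ frontier Ω then 0
  else (∫ y in frontier Ω, ‖X - y‖ ^ (-d - β) ∂σ) ^ (-(1 / β))

/-!
The limit is read off from distance functions. The functions `dist (·, (Ω j)ᶜ)` and
`dist (·, Ω j)` are `1`-Lipschitz and vanish at `0`, so along a subsequence they converge locally
uniformly to functions `u` and `v`; their sum is the limit of the distances to the boundaries. The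
limit domain is `{u > 0}`. Its boundary is the zero set of `u + v` (`DistLimit.frontier_eq`), since
limits of corkscrew points show that a limit of boundary points is a limit of points with `u > 0`.
A pointwise limit of distance functions is the distance function of its zero set
(`tendsto_infDist_eq_infDist_zero`), which turns the convergence of `v` and `u + v` into
convergence of the domains and of their boundaries in the local Hausdorff distance.

Uniformity of the limit takes two steps. Corkscrew points and Harnack chains have a bounded number
of points, so they pass to the limit (`DistLimit.corkscrewAllScales`, `DistLimit.strictHarnack`):
this gives the corkscrew condition at all scales with constant `ε`, and chains of length `N` under
the strict inequality `|X - Y| < (10 / ε) min (δ X) (δ Y)`. Those two properties of a single open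
set imply that it is uniform with constants `(ε / 4, 10 N)` (`isUniformDomain_of_allScales`): two
points with `|X - Y| ≤ (40 / ε) min (δ X) (δ Y)` are joined by three chains through corkscrew
points at scale `|X - Y| / 5`, and connectedness follows by joining two points to corkscrew points
of a large common scale.

For the measures, the upper Ahlfors bound extends to all balls with a constant independent of `j`
(`exists_upperGrowth`), which gives a weakly convergent subsequence by vague compactness
(`exists_subseq_weaklyConverges`), and testing with bump functions carries the bounds to the limit.
As the lower bound then holds at all scales, the support is unbounded.

The potentials `∫ |X - y| ^ (-d - β) dσ` have tails of size `R ^ (-β)` uniformly in `j`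
(`exists_tailBound`) and vary by a bounded factor at the scale of the distance to the
boundary (`potential_le_mul`), so they converge locally uniformly off the limit boundary. Near that
boundary all smooth distances are at most a constant times the distance to the boundary
(`smoothDist_le`). Together these give uniform convergence on compact sets
(`tendstoUniformlyOn_smoothDist`).
-/

/-! ### Extraction of subsequences and joint limits -/

/-- Diagonal extraction: a sequence of points of a countable product of bounded intervals has a
subsequence along which every coordinate converges. -/
lemma exists_subseq_tendsto_of_abs_le {ι : Type*} [Countable ι] (a : ℕ → ι → ℝ) (M : ι → ℝ)
    (h : ∀ j i, |a j i| ≤ M i) :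
    ∃ φ : ℕ → ℕ, StrictMono φ ∧ ∀ i, ∃ l, Tendsto (fun j => a (φ j) i) atTop (𝓝 l) := by
  have hK : IsCompact (Set.univ.pi fun i => Set.Icc (-M i) (M i)) :=
    isCompact_univ_pi fun i => isCompact_Icc
  obtain ⟨l, -, φ, hφ, hl⟩ := hK.tendsto_subseq (x := a) fun j i _ => abs_le.1 (h j i)
  exact ⟨φ, hφ, fun i => ⟨l i, tendsto_pi_nhds.1 hl i⟩⟩

lemma exists_tendsto_of_approx {a : ℕ → ℝ}
    (h : ∀ η > 0, ∃ b : ℕ → ℝ, (∃ l, Tendsto b atTop (𝓝 l)) ∧ ∀ j, |a j - b j| ≤ η) :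
    ∃ l, Tendsto a atTop (𝓝 l) := by
  refine cauchySeq_tendsto_of_complete (Metric.cauchySeq_iff.2 fun η hη => ?_)
  obtain ⟨b, ⟨l, hb⟩, hab⟩ := h (η / 4) (by positivity)
  obtain ⟨J, hJ⟩ := Metric.cauchySeq_iff.1 hb.cauchySeq (η / 4) (by positivity)
  refine ⟨J, fun i hi j hj => ?_⟩
  have h1 := abs_le.1 (hab i)
  have h2 := abs_le.1 (hab j)
  have h3 := hJ i hi j hj
  rw [Real.dist_eq, abs_lt] at *
  constructor <;> linarith

/-- Every bounded sequence converges along an ultrafilter; this replaces passing to further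
subsequences when limits of points are taken. -/
lemma Ultrafilter.exists_tendsto_of_eventually_mem {X ι : Type*} [TopologicalSpace X]
    (𝒰 : Ultrafilter ι) {K : Set X} (hK : IsCompact K) {z : ι → X}
    (hz : ∀ᶠ j in (𝒰 : Filter ι), z j ∈ K) :
    ∃ x ∈ K, Tendsto z 𝒰 (𝓝 x) :=
  hK.ultrafilter_le_nhds (𝒰.map z) (le_principal_iff.2 hz)

lemma tendsto_prod_of_lipschitz {X ι : Type*} [PseudoMetricSpace X] {l : Filter ι}
    {f : ι → X → ℝ} (hf : ∀ j, LipschitzWith 1 (f j)) {x : X} {a : ℝ}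
    (h : Tendsto (fun j => f j x) l (𝓝 a)) :
    Tendsto (fun p : ι × X => f p.1 p.2) (l ×ˢ 𝓝 x) (𝓝 a) := by
  have h1 : Tendsto (fun p : ι × X => f p.1 x) (l ×ˢ 𝓝 x) (𝓝 a) := h.comp tendsto_fst
  have h2 : Tendsto (fun p : ι × X => dist p.2 x) (l ×ˢ 𝓝 x) (𝓝 0) :=
    (tendsto_iff_dist_tendsto_zero.1 tendsto_id).comp tendsto_snd
  have h3 : Tendsto (fun p : ι × X => f p.1 p.2 - f p.1 x) (l ×ˢ 𝓝 x) (𝓝 0) := by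
    refine squeeze_zero_norm (fun p => ?_) h2
    simpa [Real.dist_eq] using (hf p.1).dist_le_mul p.2 x
  simpa using h3.add h1

lemma tendsto_apply_of_lipschitz {X ι : Type*} [PseudoMetricSpace X] {l : Filter ι}
    {f : ι → X → ℝ} (hf : ∀ j, LipschitzWith 1 (f j)) {x : X} {a : ℝ}
    (h : Tendsto (fun j => f j x) l (𝓝 a)) {z : ι → X} (hz : Tendsto z l (𝓝 x)) :
    Tendsto (fun j => f j (z j)) l (𝓝 a) :=
  (tendsto_prod_of_lipschitz hf h).comp (tendsto_id.prodMk hz)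

/-- Continuous convergence at every point implies uniform convergence on compact sets. -/
lemma tendstoUniformlyOn_of_forall_tendsto_prod {X : Type*} [TopologicalSpace X]
    {F : ℕ → X → ℝ} {f : X → ℝ}
    (h : ∀ x, Tendsto (fun p : ℕ × X => F p.1 p.2) (atTop ×ˢ 𝓝 x) (𝓝 (f x)))
    {K : Set X} (hK : IsCompact K) : TendstoUniformlyOn F f atTop K := by
  rw [← tendstoLocallyUniformlyOn_iff_tendstoUniformlyOn_of_compact hK,
    Metric.tendstoLocallyUniformlyOn_iff]
  intro η hη x _
  have h1 := (Metric.tendsto_nhds.1 (h x)) (η / 3) (by positivity)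
  obtain ⟨P, hP, Q, hQ, hPQ⟩ := eventually_prod_iff.1 h1
  refine ⟨{y | Q y}, mem_nhdsWithin_of_mem_nhds hQ, ?_⟩
  have hlim : ∀ y, Q y → dist (f y) (f x) ≤ η / 3 := by
    intro y hy
    have h2 : Tendsto (fun j => F j y) atTop (𝓝 (f y)) :=
      (h y).comp (tendsto_id.prodMk tendsto_const_nhds)
    refine le_of_tendsto (h2.dist tendsto_const_nhds) ?_
    filter_upwards [hP] with j hj using (hPQ hj hy).le
  filter_upwards [hP] with j hj y hy
  have h3 := hPQ hj hy
  have h4 := hlim y hy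
  have h5 := dist_triangle_right (f y) (F j y) (f x)
  simp only at h3
  linarith

/-! ### Convergence of distance functions -/

lemma lipschitzWith_one_of_tendsto {X ι : Type*} [PseudoMetricSpace X] {l : Filter ι} [l.NeBot]
    {f : ι → X → ℝ} (hf : ∀ j, LipschitzWith 1 (f j)) {g : X → ℝ}
    (h : ∀ x, Tendsto (fun j => f j x) l (𝓝 (g x))) : LipschitzWith 1 g := by
  refine LipschitzWith.of_dist_le_mul fun x y => ?_
  exact le_of_tendsto ((h x).dist (h y)) (Eventually.of_forall fun j => (hf j).dist_le_mul x y)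

/-- The pointwise limit of the distance functions of a sequence of sets vanishes somewhere, and
it is the distance function of its zero set. -/
lemma tendsto_infDist_eq_infDist_zero {X : Type*} [PseudoMetricSpace X] [ProperSpace X]
    {F : ℕ → Set X} (hF : ∀ j, (F j).Nonempty) {g : X → ℝ}
    (h : ∀ x, Tendsto (fun j => Metric.infDist x (F j)) atTop (𝓝 (g x))) (x : X) :
    {y | g y = 0}.Nonempty ∧ g x = Metric.infDist x {y | g y = 0} := by
  have hlip : ∀ j, LipschitzWith 1 (fun x => Metric.infDist x (F j)) :=
    fun j => Metric.lipschitz_infDist_pt _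
  have hg := lipschitzWith_one_of_tendsto hlip h
  have h𝒰 : (hyperfilter ℕ : Filter ℕ) ≤ atTop := Nat.hyperfilter_le_atTop
  choose y hy hxy using fun j => isClosed_closure.exists_infDist_eq_dist (hF j).closure x
  simp only [Metric.infDist_closure] at hxy
  have hlt := (h x).eventually_lt_const (lt_add_one (g x))
  obtain ⟨z, -, hz⟩ := (hyperfilter ℕ).exists_tendsto_of_eventually_mem
    (isCompact_closedBall x (g x + 1)) (z := y) (by
      filter_upwards [h𝒰 hlt] with j hj
      rw [Metric.mem_closedBall, dist_comm, ← hxy j]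
      exact hj.le)
  have hz0 : g z = 0 := by
    have h1 := tendsto_apply_of_lipschitz hlip ((h z).mono_left h𝒰) hz
    refine tendsto_nhds_unique h1 (tendsto_const_nhds.congr fun j => ?_)
    rw [← Metric.infDist_closure, Metric.infDist_zero_of_mem (hy j)]
  have hxz : g x = dist x z := by
    refine tendsto_nhds_unique ((h x).mono_left h𝒰) ?_
    simp only [hxy]
    exact tendsto_const_nhds.dist hz
  have hne : {y | g y = 0}.Nonempty := ⟨z, hz0⟩
  refine ⟨hne, le_antisymm ((Metric.le_infDist hne).2 fun w hw => ?_) ?_⟩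
  · have := hg.dist_le_mul x w
    rw [hw, Real.dist_eq, sub_zero] at this
    simpa using (le_abs_self _).trans this
  · rw [hxz]
    exact Metric.infDist_le_dist_of_mem hz0

lemma exists_subseq_tendsto_infDist {X ι : Type*} [PseudoMetricSpace X]
    [TopologicalSpace.SeparableSpace X] [Countable ι] {F : ι → ℕ → Set X} (x₀ : X)
    (h₀ : ∀ i j, Metric.infDist x₀ (F i j) = 0) :
    ∃ φ : ℕ → ℕ, StrictMono φ ∧ ∃ g : ι → X → ℝ,
      ∀ i x, Tendsto (fun j => Metric.infDist x (F i (φ j))) atTop (𝓝 (g i x)) := by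
  obtain ⟨s, hs, hsd⟩ := TopologicalSpace.exists_countable_dense X
  have := hs.to_subtype
  obtain ⟨φ, hφ, h⟩ := exists_subseq_tendsto_of_abs_le
    (fun j (p : ι × s) => Metric.infDist p.2.1 (F p.1 j)) (fun p => dist p.2.1 x₀) (by
      rintro j ⟨i, x⟩
      rw [abs_of_nonneg Metric.infDist_nonneg]
      have := Metric.infDist_le_infDist_add_dist (s := F i j) (x := x.1) (y := x₀)
      rwa [h₀, zero_add] at this)
  refine ⟨φ, hφ, ?_⟩
  have : ∀ i x, ∃ l, Tendsto (fun j => Metric.infDist x (F i (φ j))) atTop (𝓝 l) := by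
    intro i x
    refine exists_tendsto_of_approx fun η hη => ?_
    obtain ⟨y, hy, hxy⟩ := hsd.exists_dist_lt x hη
    refine ⟨_, h (i, ⟨y, hy⟩), fun j => ?_⟩
    have := (Metric.lipschitz_infDist_pt (F i (φ j))).dist_le_mul x y
    rw [Real.dist_eq, NNReal.coe_one, one_mul] at this
    exact this.trans hxy.le
  choose g hg using this
  exact ⟨g, hg⟩

lemma tendsto_localHausdorffDist {n : ℕ} {F : ℕ → Set (EuclideanSpace ℝ (Fin n))}
    {G : Set (EuclideanSpace ℝ (Fin n))}
    (h : ∀ x, Tendsto (fun j => Metric.infDist x (F j)) atTop (𝓝 (Metric.infDist x G)))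
    (x : EuclideanSpace ℝ (Fin n)) {r : ℝ} (hr : 0 < r) :
    Tendsto (fun j => localHausdorffDist x r (F j) G) atTop (𝓝 0) := by
  have hu : TendstoUniformlyOn (fun j y => Metric.infDist y (F j)) (fun y => Metric.infDist y G)
      atTop (Metric.closedBall x r) :=
    tendstoUniformlyOn_of_forall_tendsto_prod
      (fun y => tendsto_prod_of_lipschitz (fun j => Metric.lipschitz_infDist_pt _) (h y))
      (isCompact_closedBall x r)
  have hnn : ∀ A B : Set (EuclideanSpace ℝ (Fin n)),
      0 ≤ sSup ((fun y => Metric.infDist y A) '' B) := fun A B =>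
    Real.sSup_nonneg (by rintro _ ⟨y, -, rfl⟩; exact Metric.infDist_nonneg)
  rw [Metric.tendsto_nhds]
  intro η hη
  filter_upwards [Metric.tendstoUniformlyOn_iff.1 hu (r * η / 4) (by positivity)] with j hj
  have h1 : sSup ((fun y => Metric.infDist y G) '' (F j ∩ Metric.ball x r)) ≤ r * η / 4 := by
    refine Real.sSup_le ?_ (by positivity)
    rintro _ ⟨y, hy, rfl⟩
    have := hj y (Metric.ball_subset_closedBall hy.2)
    rw [Metric.infDist_zero_of_mem hy.1, Real.dist_0_eq_abs] at this
    exact (le_abs_self _).trans this.le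
  have h2 : sSup ((fun y => Metric.infDist y (F j)) '' (G ∩ Metric.ball x r)) ≤ r * η / 4 := by
    refine Real.sSup_le ?_ (by positivity)
    rintro _ ⟨y, hy, rfl⟩
    have := hj y (Metric.ball_subset_closedBall hy.2)
    rw [Metric.infDist_zero_of_mem hy.1, dist_comm, Real.dist_0_eq_abs] at this
    exact (le_abs_self _).trans this.le
  have h3 := hnn G (F j ∩ Metric.ball x r)
  have h4 := hnn (F j) (G ∩ Metric.ball x r)
  rw [Real.dist_0_eq_abs, localHausdorffDist, ← mul_add, abs_of_nonneg (by positivity),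
    one_div, inv_mul_lt_iff₀ hr]
  linarith [mul_pos hr hη]

/-- The distance to the frontier, seen from inside a set, is the distance to its complement. -/
lemma infDist_frontier_of_mem {E : Type*} [NormedAddCommGroup E] [NormedSpace ℝ E]
    [FiniteDimensional ℝ E] {s : Set E} {x : E} (hx : x ∈ s) (hs : (frontier s).Nonempty) :
    Metric.infDist x (frontier s) = Metric.infDist x sᶜ := by
  have hne : s ≠ Set.univ := by rintro rfl; simp at hs
  obtain ⟨y, hy, hxy⟩ := exists_mem_frontier_infDist_compl_eq_dist hx hne
  refine le_antisymm (hxy ▸ Metric.infDist_le_dist_of_mem hy) ?_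
  rw [← Metric.infDist_closure (s := sᶜ)]
  refine Metric.infDist_le_infDist_of_subset ?_ hs
  rw [← frontier_compl]
  exact frontier_subset_closure

lemma infDist_frontier_eq_add {E : Type*} [NormedAddCommGroup E] [NormedSpace ℝ E]
    [FiniteDimensional ℝ E] {s : Set E} (x : E) (hs : (frontier s).Nonempty) :
    Metric.infDist x (frontier s) = Metric.infDist x sᶜ + Metric.infDist x s := by
  by_cases hx : x ∈ s
  · rw [infDist_frontier_of_mem hx hs, Metric.infDist_zero_of_mem hx, add_zero]
  · have h1 := infDist_frontier_of_mem (s := sᶜ) hx (by rwa [frontier_compl])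
    rw [frontier_compl, compl_compl] at h1
    rw [h1, Metric.infDist_zero_of_mem (s := sᶜ) hx, zero_add]

/-! ### Harnack chains -/

/-- `X` and `Y` are joined by a Harnack chain of `k` steps in `Ω`. -/
def ChainJoined {n : ℕ} (Ω : Set (EuclideanSpace ℝ (Fin n))) (k : ℕ)
    (X Y : EuclideanSpace ℝ (Fin n)) : Prop :=
  ∃ Z : ℕ → EuclideanSpace ℝ (Fin n), Z 0 = X ∧ Z k = Y ∧
    ∀ i < k, dist (Z i) (Z (i + 1)) ≤ Metric.infDist (Z i) (frontier Ω) / 2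

section Chains

variable {n : ℕ} {Ω : Set (EuclideanSpace ℝ (Fin n))} {X Y W : EuclideanSpace ℝ (Fin n)}
  {ε : ℝ} {N : ℕ}

lemma ChainJoined.refl (k : ℕ) : ChainJoined Ω k X X :=
  ⟨fun _ => X, rfl, rfl, fun i _ => by
    rw [dist_self]; exact div_nonneg Metric.infDist_nonneg zero_le_two⟩

lemma ChainJoined.trans {k m : ℕ} (h₁ : ChainJoined Ω k X Y) (h₂ : ChainJoined Ω m Y W) :
    ChainJoined Ω (k + m) X W := by
  obtain ⟨Z₁, h10, h1k, h1⟩ := h₁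
  obtain ⟨Z₂, h20, h2m, h2⟩ := h₂
  refine ⟨fun i => if i ≤ k then Z₁ i else Z₂ (i - k), by simpa using h10, ?_, fun i hi => ?_⟩
  · by_cases hm : m = 0
    · subst hm; simp [h1k, ← h2m, h20]
    · simp [hm, h2m]
  · rcases lt_trichotomy i k with hik | rfl | hik
    · simpa [hik.le, Nat.succ_le_of_lt hik] using h1 i hik
    · have := h2 0 (by omega)
      simpa [h1k, ← h20] using this
    · have := h2 (i - k) (by omega)
      rw [show i - k + 1 = i + 1 - k by omega] at this
      simpa [not_le.2 hik, show ¬ i + 1 ≤ k by omega] using this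

lemma ChainJoined.mono {k m : ℕ} (h : ChainJoined Ω k X Y) (hkm : k ≤ m) :
    ChainJoined Ω m X Y := by
  simpa [Nat.add_sub_of_le hkm] using h.trans (ChainJoined.refl (m - k))

lemma ball_infDist_frontier_subset (hX : X ∈ Ω) :
    Metric.ball X (Metric.infDist X (frontier Ω)) ⊆ Ω := by
  rcases (frontier Ω).eq_empty_or_nonempty with h | h
  · simp [h]
  · intro y hy
    by_contra hyΩ
    rw [infDist_frontier_of_mem hX h, Metric.mem_ball'] at hy
    exact absurd hy (not_lt.2 (Metric.infDist_le_dist_of_mem hyΩ))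

lemma infDist_frontier_pos (hΩ : IsOpen Ω) (hne : (frontier Ω).Nonempty) (hX : X ∈ Ω) :
    0 < Metric.infDist X (frontier Ω) := by
  refine (isClosed_frontier.notMem_iff_infDist_pos hne).1 fun h => ?_
  rw [hΩ.frontier_eq] at h
  exact h.2 hX

lemma ChainJoined.mem_connectedComponentIn {k : ℕ} (hΩ : IsOpen Ω)
    (hne : (frontier Ω).Nonempty) (hX : X ∈ Ω) (h : ChainJoined Ω k X Y) :
    Y ∈ connectedComponentIn Ω X := by
  obtain ⟨Z, h0, hk, hZ⟩ := h
  have key : ∀ i ≤ k, Z i ∈ connectedComponentIn Ω X := by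
    intro i
    induction i with
    | zero => intro _; rw [h0]; exact _root_.mem_connectedComponentIn hX
    | succ i ih =>
      intro hi
      have hm := ih (by omega)
      have hmΩ := connectedComponentIn_subset Ω X hm
      have hpos := infDist_frontier_pos hΩ hne hmΩ
      rw [connectedComponentIn_eq hm]
      refine (convex_ball (Z i) (Metric.infDist (Z i) (frontier Ω))).isPreconnected
        |>.subset_connectedComponentIn (Metric.mem_ball_self hpos)
          (ball_infDist_frontier_subset hmΩ) ?_
      rw [Metric.mem_ball']
      have := hZ i (by omega)
      linarith
  exact hk ▸ key k le_rfl

/-! ### Uniformity from conditions at all scales -/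

/-- The corkscrew condition at all scales, in the form that is stable under limits. -/
def CorkscrewAllScales {n : ℕ} (Ω : Set (EuclideanSpace ℝ (Fin n))) (ε : ℝ) : Prop :=
  ∀ x ∈ frontier Ω, ∀ r : ℝ, 0 < r →
    ∃ X ∈ Ω, dist X x ≤ r ∧ ε * r ≤ Metric.infDist X (frontier Ω)

/-- The Harnack chain condition under the strict inequality
`|X - Y| < (10 / ε) min (δ X) (δ Y)`, in the form that is stable under limits. -/
def StrictHarnack {n : ℕ} (Ω : Set (EuclideanSpace ℝ (Fin n))) (ε : ℝ) (N : ℕ) : Prop :=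
  ∀ X ∈ Ω, ∀ Y ∈ Ω, ε * dist X Y < 10 * Metric.infDist X (frontier Ω) →
    ε * dist X Y < 10 * Metric.infDist Y (frontier Ω) → ChainJoined Ω N X Y

/-- A point whose distance to the boundary is at least `ε L / 40` is joined by one chain, in both
directions, to a point at distance at least `ε L / 5` from the boundary. -/
lemma StrictHarnack.exists_higher_point (hε : 0 < ε) (hε1 : ε < 1)
    (hne : (frontier Ω).Nonempty)
    (hc : CorkscrewAllScales Ω ε) (hh : StrictHarnack Ω ε N) (hX : X ∈ Ω) {L : ℝ} (hL : 0 < L)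
    (hXL : ε * L ≤ 40 * Metric.infDist X (frontier Ω)) :
    ∃ A ∈ Ω, dist X A ≤ 2 / 5 * L ∧ ε * L ≤ 5 * Metric.infDist A (frontier Ω) ∧
      ChainJoined Ω N X A ∧ ChainJoined Ω N A X := by
  rcases le_or_gt (ε * L) (5 * Metric.infDist X (frontier Ω)) with h | h
  · exact ⟨X, hX, by rw [dist_self]; positivity, h, .refl N, .refl N⟩
  · obtain ⟨x, hx, hXx⟩ := isClosed_frontier.exists_infDist_eq_dist hne X
    -- At scale `L / 5` the new point is still within one chain of `X`, and high enough that the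
    -- two points so obtained from both ends are within one chain of each other.
    obtain ⟨A, hA, hAx, hAδ⟩ := hc x hx (L / 5) (by positivity)
    set a := Metric.infDist X (frontier Ω) with ha
    have hεL : 0 < ε * L := by positivity
    have hεL1 : ε * L < L := by nlinarith
    have hXA : dist X A ≤ a + L / 5 := by
      have := dist_triangle_right X A x
      rw [← hXx] at this
      linarith
    have h1 : ε * dist X A < 10 * a := by
      have h2 : ε * dist X A ≤ ε * (a + L / 5) := by gcongr
      have h3 : ε * a ≤ a := by nlinarith [Metric.infDist_nonneg (x := X) (s := frontier Ω)]
      linarith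
    have hXA' : dist X A ≤ 2 / 5 * L := by linarith
    have h2 : ε * dist X A < 10 * Metric.infDist A (frontier Ω) := by
      have h2 : ε * dist X A ≤ ε * (2 / 5 * L) := by gcongr
      linarith
    refine ⟨A, hA, hXA', by linarith, hh X hX A hA h1 h2, hh A hA X hX ?_ ?_⟩
    · rwa [dist_comm]
    · rwa [dist_comm]

/-- Corkscrew points raise the admissible ratio from `10 / ε` to `40 / ε` at the cost of three
chains instead of one. -/
lemma StrictHarnack.chainJoined_three (hε : 0 < ε) (hε1 : ε < 1)
    (hne : (frontier Ω).Nonempty)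
    (hc : CorkscrewAllScales Ω ε) (hh : StrictHarnack Ω ε N) (hX : X ∈ Ω) (hY : Y ∈ Ω)
    (h₁ : ε * dist X Y ≤ 40 * Metric.infDist X (frontier Ω))
    (h₂ : ε * dist X Y ≤ 40 * Metric.infDist Y (frontier Ω)) :
    ChainJoined Ω (N + N + N) X Y := by
  rcases eq_or_ne X Y with rfl | hXY
  · exact .refl _
  have hL := dist_pos.2 hXY
  obtain ⟨A, hA, hXA, hAδ, hXA', -⟩ := hh.exists_higher_point hε hε1 hne hc hX hL h₁
  obtain ⟨B, hB, hYB, hBδ, -, hBY⟩ := hh.exists_higher_point hε hε1 hne hc hY hL h₂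
  have hAB : dist A B ≤ 9 / 5 * dist X Y := by
    have := dist_triangle4 A X Y B
    rw [dist_comm A X] at this
    linarith
  have h3 : ε * dist A B ≤ ε * (9 / 5 * dist X Y) := by gcongr
  have h4 : 0 < ε * dist X Y := by positivity
  exact (hXA'.trans (hh A hA B hB (by linarith) (by linarith))).trans hBY

/-- A point is connected to all corkscrew points of a nearest boundary point at scales at least
its distance to the boundary: the scale is doubled step by step. -/
lemma StrictHarnack.corkscrew_mem_connectedComponentIn (hΩ : IsOpen Ω) (hε : 0 < ε)
    (hε1 : ε < 1) (hne : (frontier Ω).Nonempty)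
    (hc : CorkscrewAllScales Ω ε) (hh : StrictHarnack Ω ε N) (hX : X ∈ Ω)
    {x : EuclideanSpace ℝ (Fin n)} (hx : x ∈ frontier Ω)
    (hXx : Metric.infDist X (frontier Ω) = dist X x) (k : ℕ) :
    ∀ t : ℝ, dist X x ≤ t → t ≤ 2 ^ (k + 1) * dist X x → ∀ A ∈ Ω, dist A x ≤ t →
      ε * t ≤ Metric.infDist A (frontier Ω) → A ∈ connectedComponentIn Ω X := by
  have hr : 0 < dist X x := hXx ▸ infDist_frontier_pos hΩ hne hX
  induction k with
  | zero =>
    intro t ht1 ht2 A hA hAx hAδ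
    have hXA : dist X A ≤ dist X x + t := by
      have := dist_triangle_right X A x
      linarith
    have hεt : 0 < ε * t := mul_pos hε (hr.trans_le ht1)
    refine (hh X hX A hA ?_ ?_).mem_connectedComponentIn hΩ hne hX
    · rw [hXx]
      have : ε * dist X A ≤ 1 * dist X A := by gcongr
      norm_num at ht2
      linarith
    · have : ε * dist X A ≤ ε * (t + t) := by gcongr; linarith
      linarith
  | succ k ih =>
    intro t ht1 ht2 A hA hAx hAδ
    rcases le_or_gt t (2 ^ (k + 1) * dist X x) with h | h
    · exact ih t ht1 h A hA hAx hAδ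
    have h2 : (2 : ℝ) ≤ 2 ^ (k + 1) := by
      rw [pow_succ]; linarith [one_le_pow₀ (one_le_two : (1 : ℝ) ≤ 2) (n := k)]
    have ht : 0 < t := hr.trans_le ht1
    have hεt : 0 < ε * t := by positivity
    obtain ⟨B, hB, hBx, hBδ⟩ := hc x hx (t / 2) (by positivity)
    have hBm := ih (t / 2) (by nlinarith) (by rw [pow_succ] at ht2; linarith) B hB hBx hBδ
    have hBA : ε * dist B A ≤ ε * (3 / 2 * t) := by
      gcongr
      have := dist_triangle_right B A x
      linarith
    rw [connectedComponentIn_eq hBm]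
    exact (hh B hB A hA (by linarith) (by linarith)).mem_connectedComponentIn hΩ hne hB

lemma StrictHarnack.isPreconnected (hΩ : IsOpen Ω) (hε : 0 < ε)
    (hε1 : ε < 1) (hne : (frontier Ω).Nonempty)
    (hc : CorkscrewAllScales Ω ε) (hh : StrictHarnack Ω ε N) : IsPreconnected Ω := by
  refine isPreconnected_of_forall_pair fun X hX Y hY => ?_
  suffices h : Y ∈ connectedComponentIn Ω X from
    ⟨_, connectedComponentIn_subset Ω X, mem_connectedComponentIn hX, h,
      isPreconnected_connectedComponentIn⟩
  obtain ⟨x, hx, hXx⟩ := isClosed_frontier.exists_infDist_eq_dist hne X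
  obtain ⟨y, hy, hYy⟩ := isClosed_frontier.exists_infDist_eq_dist hne Y
  have hr : 0 < dist X x := hXx ▸ infDist_frontier_pos hΩ hne hX
  have hs : 0 < dist Y y := hYy ▸ infDist_frontier_pos hΩ hne hY
  set t := dist X x + dist Y y + dist x y with ht
  have htx : dist X x ≤ t := by linarith [dist_nonneg (x := x) (y := y)]
  have hty : dist Y y ≤ t := by linarith [dist_nonneg (x := x) (y := y)]
  have ht0 : 0 < t := hr.trans_le htx
  have hεt : 0 < ε * t := by positivity
  have hpow : ∀ a : ℝ, 0 < a → ∃ k : ℕ, t ≤ 2 ^ (k + 1) * a := by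
    intro a ha
    obtain ⟨k, hk⟩ := pow_unbounded_of_one_lt (t / a) (one_lt_two : (1 : ℝ) < 2)
    refine ⟨k, ?_⟩
    rw [div_lt_iff₀ ha] at hk
    rw [pow_succ]
    nlinarith [pow_pos (zero_lt_two : (0 : ℝ) < 2) k]
  obtain ⟨k, hk⟩ := hpow _ hr
  obtain ⟨m, hm⟩ := hpow _ hs
  obtain ⟨A, hA, hAx, hAδ⟩ := hc x hx t ht0
  obtain ⟨B, hB, hBy, hBδ⟩ := hc y hy t ht0
  have h1 := hh.corkscrew_mem_connectedComponentIn hΩ hε hε1 hne hc hX hx hXx k t htx hk A hA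
    hAx hAδ
  have h2 := hh.corkscrew_mem_connectedComponentIn hΩ hε hε1 hne hc hY hy hYy m t hty hm B hB
    hBy hBδ
  have hAB : ε * dist A B ≤ ε * (3 * t) := by
    gcongr
    have := dist_triangle4 A x y B
    rw [dist_comm y B] at this
    linarith
  have h3 := (hh A hA B hB (by linarith) (by linarith)).mem_connectedComponentIn hΩ hne hA
  rw [connectedComponentIn_eq h1, connectedComponentIn_eq h3, ← connectedComponentIn_eq h2]
  exact mem_connectedComponentIn hY

lemma isUniformDomain_of_allScales (hΩ : IsOpen Ω) (hε : 0 < ε) (hε1 : ε < 1)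
    (hne : (frontier Ω).Nonempty) (hc : CorkscrewAllScales Ω ε) (hh : StrictHarnack Ω ε N) :
    IsUniformDomain Ω (ε / 4) (10 * N) where
  isDomain := by
    obtain ⟨x, hx⟩ := hne
    obtain ⟨X, hX, -⟩ := hc x hx 1 one_pos
    exact ⟨hΩ, ⟨X, hX⟩, hh.isPreconnected hΩ hε hε1 ⟨x, hx⟩ hc⟩
  eps_pos := by positivity
  eps_lt_one := by linarith
  corkscrew := by
    intro x hx r hr _
    obtain ⟨X, hX, hXx, hXδ⟩ := hc x hx (r / 2) (by positivity)
    refine ⟨X, ⟨hX, by rw [Metric.mem_ball]; linarith⟩, ?_⟩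
    refine (Metric.ball_subset_ball ?_).trans (ball_infDist_frontier_subset hX)
    have : 0 < ε * r := by positivity
    linarith
  harnack := by
    intro X hX Y hY h
    have hX' := infDist_frontier_pos hΩ hne hX
    have hY' := infDist_frontier_pos hΩ hne hY
    rw [div_le_iff₀ (lt_min hX' hY'), div_div_eq_mul_div, div_mul_eq_mul_div,
      le_div_iff₀ hε] at h
    have h1 := min_le_left (Metric.infDist X (frontier Ω)) (Metric.infDist Y (frontier Ω))
    have h2 := min_le_right (Metric.infDist X (frontier Ω)) (Metric.infDist Y (frontier Ω))
    exact (hh.chainJoined_three hε hε1 hne hc hX hY (by linarith) (by linarith)).mono (by omega)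

end Chains

/-! ### The limit domain -/

/-- `u` and `v` are the pointwise limits of the distances to the complements of the sets `Ω j`
and to the sets `Ω j`; every `Ω j` is open with a nonempty boundary. -/
structure DistLimit {n : ℕ} (Ω : ℕ → Set (EuclideanSpace ℝ (Fin n)))
    (u v : EuclideanSpace ℝ (Fin n) → ℝ) : Prop where
  isOpen : ∀ j, IsOpen (Ω j)
  frontier_nonempty : ∀ j, (frontier (Ω j)).Nonempty
  tendsto_compl : ∀ x, Tendsto (fun j => Metric.infDist x (Ω j)ᶜ) atTop (𝓝 (u x))
  tendsto_self : ∀ x, Tendsto (fun j => Metric.infDist x (Ω j)) atTop (𝓝 (v x))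

namespace DistLimit

variable {n : ℕ} {Ω : ℕ → Set (EuclideanSpace ℝ (Fin n))}
  {u v : EuclideanSpace ℝ (Fin n) → ℝ} {ε : ℝ} {N : ℕ}

lemma tendsto_frontier (h : DistLimit Ω u v) (x : EuclideanSpace ℝ (Fin n)) :
    Tendsto (fun j => Metric.infDist x (frontier (Ω j))) atTop (𝓝 (u x + v x)) := by
  simp only [infDist_frontier_eq_add x (h.frontier_nonempty _)]
  exact (h.tendsto_compl x).add (h.tendsto_self x)

lemma continuous_compl (h : DistLimit Ω u v) : Continuous u :=
  (lipschitzWith_one_of_tendsto (fun _ => Metric.lipschitz_infDist_pt _) h.tendsto_compl).continuous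

lemma continuous_self (h : DistLimit Ω u v) : Continuous v :=
  (lipschitzWith_one_of_tendsto (fun _ => Metric.lipschitz_infDist_pt _) h.tendsto_self).continuous

lemma compl_nonneg (h : DistLimit Ω u v) (x : EuclideanSpace ℝ (Fin n)) : 0 ≤ u x :=
  ge_of_tendsto' (h.tendsto_compl x) fun _ => Metric.infDist_nonneg

lemma self_nonneg (h : DistLimit Ω u v) (x : EuclideanSpace ℝ (Fin n)) : 0 ≤ v x :=
  ge_of_tendsto' (h.tendsto_self x) fun _ => Metric.infDist_nonneg

lemma isOpen_limit (h : DistLimit Ω u v) : IsOpen {x | 0 < u x} :=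
  isOpen_lt continuous_const h.continuous_compl

lemma eventually_mem (h : DistLimit Ω u v) {x : EuclideanSpace ℝ (Fin n)} (hx : 0 < u x) :
    ∀ᶠ j in atTop, x ∈ Ω j := by
  filter_upwards [(h.tendsto_compl x).eventually_const_lt hx] with j hj
  by_contra hxj
  exact hj.ne' (Metric.infDist_zero_of_mem hxj)

lemma self_eq_zero (h : DistLimit Ω u v) {x : EuclideanSpace ℝ (Fin n)} (hx : 0 < u x) :
    v x = 0 := by
  refine tendsto_nhds_unique (h.tendsto_self x) (tendsto_const_nhds.congr' ?_)
  filter_upwards [h.eventually_mem hx] with j hj using (Metric.infDist_zero_of_mem hj).symm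

/-- Points of the limit set are limits of boundary points. -/
lemma exists_frontier_tendsto (h : DistLimit Ω u v) {x : EuclideanSpace ℝ (Fin n)}
    (hx : u x + v x = 0) :
    ∃ y : ℕ → EuclideanSpace ℝ (Fin n), (∀ j, y j ∈ frontier (Ω j)) ∧
      Tendsto y atTop (𝓝 x) := by
  choose y hy hxy using fun j =>
    isClosed_frontier.exists_infDist_eq_dist (h.frontier_nonempty j) x
  refine ⟨y, hy, tendsto_iff_dist_tendsto_zero.2 ?_⟩
  simpa only [dist_comm _ x, ← hxy, hx] using h.tendsto_frontier x

/-- Limits of corkscrew points are corkscrew points. -/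
lemma exists_corkscrew (h : DistLimit Ω u v)
    (hc : ∀ j, CorkscrewCondition (Ω j) ε)
    (hd : ∀ r : ℝ, ∀ᶠ j in atTop, ENNReal.ofReal r < Metric.ediam (Ω j))
    {x : EuclideanSpace ℝ (Fin n)} (hx : u x + v x = 0) {r : ℝ} (hr : 0 < r) :
    ∃ X, dist X x ≤ r ∧ ε * r ≤ u X := by
  have h𝒰 : (hyperfilter ℕ : Filter ℕ) ≤ atTop := Nat.hyperfilter_le_atTop
  obtain ⟨y, hy, hyx⟩ := h.exists_frontier_tendsto hx
  have hex : ∀ᶠ j in atTop, ∃ X, dist X (y j) < r ∧ ε * r ≤ Metric.infDist X (Ω j)ᶜ := by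
    filter_upwards [hd r] with j hj
    obtain ⟨X, ⟨-, hXy⟩, hX⟩ := hc j (y j) (hy j) r hr hj
    have hyΩ : y j ∈ (Ω j)ᶜ := fun hmem => by
      have := hy j
      rw [(h.isOpen j).frontier_eq] at this
      exact this.2 hmem
    refine ⟨X, hXy, (Metric.le_infDist ⟨_, hyΩ⟩).2 fun z hz => ?_⟩
    by_contra hlt
    exact hz (hX (by rw [Metric.mem_ball']; exact not_le.1 hlt))
  obtain ⟨X, hX⟩ := hex.choice
  obtain ⟨Z, -, hZ⟩ := (hyperfilter ℕ).exists_tendsto_of_eventually_mem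
    (isCompact_closedBall x (r + 1)) (z := X) (by
      filter_upwards [h𝒰 hX, h𝒰 (Metric.tendsto_nhds.1 hyx 1 one_pos)] with j h1 h2
      have := dist_triangle (X j) (y j) x
      rw [Metric.mem_closedBall]
      linarith [h1.1])
  refine ⟨Z, ?_, ?_⟩
  · refine le_of_tendsto_of_tendsto (hZ.dist (hyx.mono_left h𝒰)) tendsto_const_nhds ?_
    filter_upwards [h𝒰 hX] with j hj using hj.1.le
  · refine ge_of_tendsto (tendsto_apply_of_lipschitz (fun j => Metric.lipschitz_infDist_pt _)
      ((h.tendsto_compl Z).mono_left h𝒰) hZ) ?_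
    filter_upwards [h𝒰 hX] with j hj using hj.2

/-- The boundary of the limit domain is the limit of the boundaries. The corkscrew points are what
keeps the limit of the boundaries in the closure of the limit domain. -/
lemma frontier_eq (h : DistLimit Ω u v) (hε : 0 < ε)
    (hc : ∀ j, CorkscrewCondition (Ω j) ε)
    (hd : ∀ r : ℝ, ∀ᶠ j in atTop, ENNReal.ofReal r < Metric.ediam (Ω j)) :
    frontier {x | 0 < u x} = {x | u x + v x = 0} := by
  ext x
  rw [h.isOpen_limit.frontier_eq]
  constructor
  · rintro ⟨hx, hux⟩
    have hu : u x = 0 := le_antisymm (not_lt.1 hux) (h.compl_nonneg x)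
    have hv : v x = 0 := closure_minimal (fun y (hy : 0 < u y) => h.self_eq_zero hy)
      (isClosed_eq h.continuous_self continuous_const) hx
    simp [hu, hv]
  · intro hx
    have hx' : u x + v x = 0 := hx
    have hu : u x = 0 := by linarith [h.compl_nonneg x, h.self_nonneg x]
    refine ⟨Metric.mem_closure_iff.2 fun η hη => ?_, by simp [hu]⟩
    obtain ⟨X, hXx, hX⟩ := h.exists_corkscrew hc hd hx (half_pos hη)
    refine ⟨X, lt_of_lt_of_le (by positivity) hX, ?_⟩
    rw [dist_comm]
    linarith

lemma closure_eq (h : DistLimit Ω u v) (hε : 0 < ε)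
    (hc : ∀ j, CorkscrewCondition (Ω j) ε)
    (hd : ∀ r : ℝ, ∀ᶠ j in atTop, ENNReal.ofReal r < Metric.ediam (Ω j)) :
    closure {x | 0 < u x} = {x | v x = 0} := by
  rw [closure_eq_self_union_frontier, h.frontier_eq hε hc hd]
  ext x
  constructor
  · rintro (hx | hx)
    · exact h.self_eq_zero hx
    · have hx' : u x + v x = 0 := hx
      exact le_antisymm (by linarith [h.compl_nonneg x]) (h.self_nonneg x)
  · intro hx
    have hx' : v x = 0 := hx
    rcases (h.compl_nonneg x).eq_or_lt with hu | hu
    · right; simp [← hu, hx']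
    · exact .inl hu

lemma infDist_frontier (h : DistLimit Ω u v) (hε : 0 < ε)
    (hc : ∀ j, CorkscrewCondition (Ω j) ε)
    (hd : ∀ r : ℝ, ∀ᶠ j in atTop, ENNReal.ofReal r < Metric.ediam (Ω j))
    (x : EuclideanSpace ℝ (Fin n)) :
    u x + v x = Metric.infDist x (frontier {x | 0 < u x}) := by
  rw [h.frontier_eq hε hc hd]
  exact (tendsto_infDist_eq_infDist_zero h.frontier_nonempty h.tendsto_frontier x).2

lemma infDist_self (h : DistLimit Ω u v) (hε : 0 < ε)
    (hc : ∀ j, CorkscrewCondition (Ω j) ε)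
    (hd : ∀ r : ℝ, ∀ᶠ j in atTop, ENNReal.ofReal r < Metric.ediam (Ω j))
    (x : EuclideanSpace ℝ (Fin n)) :
    v x = Metric.infDist x {x | 0 < u x} := by
  rw [← Metric.infDist_closure, h.closure_eq hε hc hd]
  refine (tendsto_infDist_eq_infDist_zero (fun j => ?_) h.tendsto_self x).2
  rw [← closure_nonempty_iff]
  exact (h.frontier_nonempty j).mono frontier_subset_closure

/-- Limits of Harnack chains are Harnack chains. -/
lemma strictHarnack (h : DistLimit Ω u v) (hε : 0 < ε)
    (hc : ∀ j, CorkscrewCondition (Ω j) ε)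
    (hd : ∀ r : ℝ, ∀ᶠ j in atTop, ENNReal.ofReal r < Metric.ediam (Ω j))
    (hh : ∀ j, HarnackChainCondition (Ω j) ε N) :
    StrictHarnack {x | 0 < u x} ε N := by
  intro X hX Y hY hX1 hY1
  have h𝒰 : (hyperfilter ℕ : Filter ℕ) ≤ atTop := Nat.hyperfilter_le_atTop
  have hlip : ∀ j, LipschitzWith 1 (fun x => Metric.infDist x (frontier (Ω j))) :=
    fun j => Metric.lipschitz_infDist_pt _
  have hδ := h.infDist_frontier hε hc hd
  have hex : ∀ᶠ j in atTop, ∃ Z : ℕ → EuclideanSpace ℝ (Fin n), Z 0 = X ∧ Z N = Y ∧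
      ∀ i < N, dist (Z i) (Z (i + 1)) ≤ Metric.infDist (Z i) (frontier (Ω j)) / 2 := by
    rw [← hδ] at hX1 hY1
    filter_upwards [((h.tendsto_frontier X).const_mul 10).eventually_const_lt hX1,
      ((h.tendsto_frontier Y).const_mul 10).eventually_const_lt hY1, h.eventually_mem hX,
      h.eventually_mem hY] with j hj1 hj2 hXj hYj
    refine hh j X hXj Y hYj ?_
    have hpos := lt_min (infDist_frontier_pos (h.isOpen j) (h.frontier_nonempty j) hXj)
      (infDist_frontier_pos (h.isOpen j) (h.frontier_nonempty j) hYj)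
    rw [div_le_iff₀ hpos, div_mul_eq_mul_div, le_div_iff₀ hε,
      mul_min_of_nonneg _ _ (by norm_num), mul_comm]
    exact le_min hj1.le hj2.le
  obtain ⟨Z, hZ⟩ := hex.choice
  have hZ' := h𝒰 hZ
  have hlim : ∀ i, i ≤ N → ∃ z, Tendsto (fun j => Z j i) (hyperfilter ℕ) (𝓝 z) := by
    intro i
    induction i with
    | zero =>
      refine fun _ => ⟨X, tendsto_const_nhds.congr' ?_⟩
      filter_upwards [hZ'] with j hj using hj.1.symm
    | succ i ih =>
      intro hi
      obtain ⟨z, hz⟩ := ih (by omega)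
      have hδz := tendsto_apply_of_lipschitz hlip ((h.tendsto_frontier z).mono_left h𝒰) hz
      obtain ⟨w, -, hw⟩ := (hyperfilter ℕ).exists_tendsto_of_eventually_mem
        (isCompact_closedBall z (1 + (u z + v z + 1) / 2)) (z := fun j => Z j (i + 1)) (by
          filter_upwards [hZ', Metric.tendsto_nhds.1 hz 1 one_pos,
            hδz.eventually_lt_const (lt_add_one _)] with j h1 h2 h3
          have h4 := h1.2.2 i (by omega)
          have h5 := dist_triangle_left (Z j (i + 1)) z (Z j i)
          rw [Metric.mem_closedBall]
          linarith)
      exact ⟨w, hw⟩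
  choose! z hz using hlim
  refine ⟨z, ?_, ?_, fun i hi => ?_⟩
  · refine tendsto_nhds_unique (hz 0 (Nat.zero_le N)) (tendsto_const_nhds.congr' ?_)
    filter_upwards [hZ'] with j hj using hj.1.symm
  · refine tendsto_nhds_unique (hz N le_rfl) (tendsto_const_nhds.congr' ?_)
    filter_upwards [hZ'] with j hj using hj.2.1.symm
  · rw [← hδ]
    have h1 := hz i hi.le
    refine le_of_tendsto_of_tendsto (h1.dist (hz (i + 1) hi))
      ((tendsto_apply_of_lipschitz hlip ((h.tendsto_frontier _).mono_left h𝒰) h1).div_const 2) ?_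
    filter_upwards [hZ'] with j hj using hj.2.2 i hi

lemma corkscrewAllScales (h : DistLimit Ω u v) (hε : 0 < ε)
    (hc : ∀ j, CorkscrewCondition (Ω j) ε)
    (hd : ∀ r : ℝ, ∀ᶠ j in atTop, ENNReal.ofReal r < Metric.ediam (Ω j)) :
    CorkscrewAllScales {x | 0 < u x} ε := by
  intro x hx r hr
  rw [h.frontier_eq hε hc hd] at hx
  obtain ⟨X, hXx, hX⟩ := h.exists_corkscrew hc hd hx hr
  refine ⟨X, lt_of_lt_of_le (by positivity) hX, hXx, ?_⟩
  rw [← h.infDist_frontier hε hc hd]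
  linarith [h.self_nonneg X]

end DistLimit

/-! ### Upper growth at all centres and all scales -/

/-- The measure of every closed ball, with arbitrary centre and radius, is at most `A r ^ d`. -/
def UpperGrowth {n : ℕ} (d A : ℝ) (σ : Measure (EuclideanSpace ℝ (Fin n))) : Prop :=
  ∀ y, ∀ r : ℝ, 0 < r → σ (Metric.closedBall y r) ≤ ENNReal.ofReal (A * r ^ d)

lemma UpperGrowth.isFiniteMeasureOnCompacts {n : ℕ} {d A : ℝ}
    {σ : Measure (EuclideanSpace ℝ (Fin n))} (h : UpperGrowth d A σ) :
    IsFiniteMeasureOnCompacts σ := by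
  refine ⟨fun K hK => ?_⟩
  obtain ⟨r, hr⟩ := hK.isBounded.subset_closedBall 0
  have h1 : K ⊆ Metric.closedBall 0 (max r 1) :=
    hr.trans (Metric.closedBall_subset_closedBall (le_max_left _ _))
  exact (measure_mono h1).trans_lt ((h 0 _ (by positivity)).trans_lt ENNReal.ofReal_lt_top)

lemma exists_card_cover_closedBall (E : Type*) [NormedAddCommGroup E] [NormedSpace ℝ E]
    [ProperSpace E] {η : ℝ} (hη : 0 < η) :
    ∃ M : ℕ, ∀ (y : E) (r : ℝ), 0 < r → ∃ t : Finset E, t.card ≤ M ∧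
      Metric.closedBall y r ⊆ ⋃ z ∈ t, Metric.ball z (η * r) := by
  classical
  obtain ⟨t, -, htf, ht⟩ := (isCompact_closedBall (0 : E) 1).finite_cover_balls hη
  refine ⟨htf.toFinset.card, fun y r hr => ⟨htf.toFinset.image fun z => y + r • z,
    Finset.card_image_le, fun w hw => ?_⟩⟩
  have h1 : r⁻¹ • (w - y) ∈ Metric.closedBall (0 : E) 1 := by
    rw [mem_closedBall_zero_iff, norm_smul, norm_inv, Real.norm_of_nonneg hr.le,
      inv_mul_le_iff₀ hr, mul_one, ← dist_eq_norm]
    exact hw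
  obtain ⟨z, hz, hwz⟩ := Set.mem_iUnion₂.1 (ht h1)
  refine Set.mem_iUnion₂.2 ⟨y + r • z, Finset.mem_image_of_mem _ (htf.mem_toFinset.2 hz), ?_⟩
  rw [Metric.mem_ball, dist_eq_norm] at hwz ⊢
  have h2 : w - (y + r • z) = r • (r⁻¹ • (w - y) - z) := by
    rw [smul_sub, smul_inv_smul₀ hr.ne', sub_sub]
  rw [h2, norm_smul, Real.norm_of_nonneg hr.le, mul_comm η]
  exact mul_lt_mul_of_pos_left hwz hr

/-- The upper bound in Ahlfors regularity, assumed for balls centred on `E` of radius less than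
`diam E`, holds for all balls, with a constant that depends only on `n` and `C`. At scales larger
than `diam E`, the set is covered by a bounded number of balls of radius `diam E / 2`. -/
lemma exists_upperGrowth (n : ℕ) {d C : ℝ} (hd : 0 < d) (hC : 0 < C) :
    ∃ A > 0, ∀ (E : Set (EuclideanSpace ℝ (Fin n))) (σ : Measure (EuclideanSpace ℝ (Fin n))),
      E.Nonempty → 0 < Metric.ediam E → IsAhlforsRegular d C E σ → UpperGrowth d A σ := by
  obtain ⟨M, hM⟩ := exists_card_cover_closedBall (EuclideanSpace ℝ (Fin n))
    (η := 1 / 4) (by norm_num)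
  refine ⟨(M + 1) * C, by positivity, fun E σ hE hdiam h => ?_⟩
  have hsmall : ∀ y, ∀ r : ℝ, 0 < r → ENNReal.ofReal (r / 2) < Metric.ediam E →
      σ (Metric.closedBall y r) ≤ ENNReal.ofReal ((M + 1) * C * r ^ d) := by
    intro y r hr hrE
    obtain ⟨t, htM, ht⟩ := hM y r hr
    have hball : ∀ z, σ (Metric.ball z (1 / 4 * r)) ≤ ENNReal.ofReal (C * r ^ d) := by
      intro z
      by_cases hz : ∃ e ∈ E, e ∈ Metric.ball z (1 / 4 * r)
      · obtain ⟨e, he, hez⟩ := hz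
        have hsub : Metric.ball z (1 / 4 * r) ⊆ Metric.ball e (r / 2) := by
          refine Metric.ball_subset_ball' ?_
          rw [Metric.mem_ball'] at hez
          linarith
        refine (measure_mono hsub).trans ((h.upper e he _ (by positivity) hrE).trans ?_)
        gcongr
        linarith
      · have : Metric.ball z (1 / 4 * r) ⊆ Eᶜ := fun w hw hwE => hz ⟨w, hwE, hw⟩
        rw [measure_mono_null this h.supported]
        exact zero_le
    calc σ (Metric.closedBall y r) ≤ σ (⋃ z ∈ t, Metric.ball z (1 / 4 * r)) := measure_mono ht
      _ ≤ ∑ z ∈ t, σ (Metric.ball z (1 / 4 * r)) := measure_biUnion_finset_le _ _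
      _ ≤ ∑ _z ∈ t, ENNReal.ofReal (C * r ^ d) := Finset.sum_le_sum fun z _ => hball z
      _ = t.card * ENNReal.ofReal (C * r ^ d) := by rw [Finset.sum_const, nsmul_eq_mul]
      _ ≤ ((M + 1 : ℕ) : ENNReal) * ENNReal.ofReal (C * r ^ d) := by
        gcongr
        omega
      _ = ENNReal.ofReal ((M + 1) * C * r ^ d) := by
        rw [← ENNReal.ofReal_natCast, ← ENNReal.ofReal_mul (by positivity)]
        push_cast
        ring_nf
  intro y r hr
  rcases lt_or_ge (ENNReal.ofReal (r / 2)) (Metric.ediam E) with hrE | hrE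
  · exact hsmall y r hr hrE
  · have hfin : Metric.ediam E ≠ ⊤ := (hrE.trans_lt ENNReal.ofReal_lt_top).ne
    obtain ⟨e, he⟩ := hE
    set D := (Metric.ediam E).toReal with hD
    have hDE : ENNReal.ofReal D = Metric.ediam E := ENNReal.ofReal_toReal hfin
    have hD0 : 0 < D := ENNReal.toReal_pos hdiam.ne' hfin
    have hDr : D ≤ r := by
      rw [← hDE] at hrE
      linarith [(ENNReal.ofReal_le_ofReal_iff (by positivity)).1 hrE]
    have hsub : E ⊆ Metric.closedBall e D := fun w hw => by
      rw [Metric.mem_closedBall]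
      have := Metric.edist_le_ediam_of_mem hw he
      rw [edist_dist, ← hDE] at this
      exact (ENNReal.ofReal_le_ofReal_iff hD0.le).1 this
    calc σ (Metric.closedBall y r) ≤ σ (Metric.closedBall e D ∪ Eᶜ) :=
          measure_mono fun w _ => (em (w ∈ E)).imp (fun hw => hsub hw) id
      _ ≤ σ (Metric.closedBall e D) + σ Eᶜ := measure_union_le _ _
      _ = σ (Metric.closedBall e D) := by rw [h.supported, add_zero]
      _ ≤ ENNReal.ofReal ((M + 1) * C * D ^ d) := by
        refine hsmall e D hD0 ?_
        rw [← hDE]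
        exact (ENNReal.ofReal_lt_ofReal_iff hD0).2 (by linarith)
      _ ≤ ENNReal.ofReal ((M + 1) * C * r ^ d) := by gcongr

/-! ### Compactness of locally bounded sequences of measures -/

lemma abs_integral_le_of_support_subset {n : ℕ} {μ : Measure (EuclideanSpace ℝ (Fin n))}
    [IsFiniteMeasureOnCompacts μ] {f : EuclideanSpace ℝ (Fin n) → ℝ} {η R : ℝ}
    (hf : ∀ x ∈ Metric.closedBall 0 R, |f x| ≤ η) (hR : ∀ x ∉ Metric.closedBall 0 R, f x = 0) :
    |∫ x, f x ∂μ| ≤ η * μ.real (Metric.closedBall 0 R) := by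
  rw [← setIntegral_eq_integral_of_forall_compl_eq_zero hR]
  exact norm_setIntegral_le_of_norm_le_const (f := f)
    (isCompact_closedBall _ _).measure_lt_top hf

/-- Vague compactness: a sequence of measures that is bounded on every ball has a weakly
convergent subsequence. The integrals of countably many test functions are made to converge, then
those of all continuous functions with compact support converge, and the limit functional is
represented by a measure. -/
theorem exists_subseq_weaklyConverges {n : ℕ} (σ : ℕ → Measure (EuclideanSpace ℝ (Fin n)))
    [∀ j, IsFiniteMeasureOnCompacts (σ j)] (M : ℝ → ℝ)
    (hM : ∀ j R, (σ j).real (Metric.closedBall 0 R) ≤ M R) :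
    ∃ φ : ℕ → ℕ, StrictMono φ ∧ ∃ ν : Measure (EuclideanSpace ℝ (Fin n)),
      IsFiniteMeasureOnCompacts ν ∧ WeaklyConverges (fun j => σ (φ j)) ν := by
  let χ : ℕ → ContDiffBump (0 : EuclideanSpace ℝ (Fin n)) := fun m =>
    ⟨m + 1, m + 2, by positivity, by linarith⟩
  have hχ0 : ∀ m : ℕ, ∀ x ∉ Metric.closedBall (0 : EuclideanSpace ℝ (Fin n)) (m + 2), χ m x = 0 :=
    fun m x hx => (χ m).zero_of_le_dist (not_le.1 hx).le
  have hχle : ∀ m x, |χ m x| ≤ 1 := fun m x => by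
    rw [abs_of_nonneg (χ m).nonneg]; exact (χ m).le_one
  obtain ⟨S, hSc, hSd⟩ :=
    TopologicalSpace.exists_countable_dense C(EuclideanSpace ℝ (Fin n), ℝ)
  have := hSc.to_subtype
  have hbd : ∀ p : ℕ × S, ∃ B : ℝ, ∀ j, |∫ x, χ p.1 x * p.2.1 x ∂(σ j)| ≤ B := by
    rintro ⟨m, g, -⟩
    obtain ⟨B, hB⟩ := (isCompact_closedBall (0 : EuclideanSpace ℝ (Fin n)) (m + 2)
      ).exists_bound_of_continuousOn g.continuous.continuousOn
    have hB0 : 0 ≤ B := (norm_nonneg _).trans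
      (hB 0 (Metric.mem_closedBall_self (by positivity)))
    refine ⟨B * M (m + 2), fun j => ?_⟩
    refine (abs_integral_le_of_support_subset (η := B) (R := m + 2) ?_ ?_).trans
      (mul_le_mul_of_nonneg_left (hM j _) hB0)
    · intro x hx
      rw [abs_mul]
      calc |χ m x| * |g x| ≤ 1 * B := mul_le_mul (hχle m x) (hB x hx) (abs_nonneg _) zero_le_one
        _ = B := one_mul B
    · intro x hx
      simp only [hχ0 m x hx, zero_mul]
  choose B hB using hbd
  obtain ⟨φ, hφ, hlim⟩ := exists_subseq_tendsto_of_abs_le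
    (fun j (p : ℕ × S) => ∫ x, χ p.1 x * p.2.1 x ∂(σ j)) B (fun j p => hB p j)
  have hconv : ∀ f : EuclideanSpace ℝ (Fin n) → ℝ, Continuous f → HasCompactSupport f →
      ∃ l, Tendsto (fun j => ∫ x, f x ∂(σ (φ j))) atTop (𝓝 l) := by
    intro f hf hfs
    obtain ⟨R, hR⟩ := hfs.isBounded.subset_closedBall 0
    obtain ⟨m, hm⟩ := exists_nat_ge R
    have hfχ : ∀ x, χ m x * f x = f x := by
      intro x
      by_cases hx : x ∈ Metric.closedBall (0 : EuclideanSpace ℝ (Fin n)) (m + 1)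
      · rw [(χ m).one_of_mem_closedBall hx, one_mul]
      · have : f x = 0 := image_eq_zero_of_notMem_tsupport fun h => hx
          (Metric.closedBall_subset_closedBall (by linarith) (hR h))
        rw [this, mul_zero]
    refine exists_tendsto_of_approx fun η hη => ?_
    have hM0 : 0 ≤ M (m + 2) := measureReal_nonneg.trans (hM 0 _)
    set η' := η / (M (m + 2) + 1) with hη'
    have hη'0 : 0 < η' := by positivity
    obtain ⟨g, hgS, hg⟩ := mem_closure_iff_seq_limit.1 (hSd ⟨f, hf⟩)
    have hgu := ContinuousMap.tendsto_iff_forall_isCompact_tendstoUniformlyOn.1 hg _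
      (isCompact_closedBall (0 : EuclideanSpace ℝ (Fin n)) (m + 2))
    obtain ⟨k, hk⟩ := (Metric.tendstoUniformlyOn_iff.1 hgu η' hη'0).exists
    refine ⟨_, hlim (m, ⟨g k, hgS k⟩), fun j => ?_⟩
    have hint : ∀ h : C(EuclideanSpace ℝ (Fin n), ℝ),
        Integrable (fun x => χ m x * h x) (σ (φ j)) := fun h =>
      ((χ m).continuous.mul h.continuous).integrable_of_hasCompactSupport
        (χ m).hasCompactSupport.mul_right
    have heq : ∫ x, f x ∂(σ (φ j)) - ∫ x, χ m x * g k x ∂(σ (φ j)) =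
        ∫ x, χ m x * (f x - g k x) ∂(σ (φ j)) := by
      have := hint ⟨f, hf⟩
      simp only [ContinuousMap.coe_mk] at this
      rw [← integral_congr_ae (Eventually.of_forall hfχ), ← integral_sub this (hint (g k))]
      simp only [mul_sub]
    simp only
    rw [heq]
    refine (abs_integral_le_of_support_subset (η := η') (R := m + 2) ?_ ?_).trans ?_
    · intro x hx
      rw [abs_mul]
      have h1 := hk x hx
      rw [ContinuousMap.coe_mk, Real.dist_eq] at h1
      calc |χ m x| * |f x - g k x| ≤ 1 * η' :=
            mul_le_mul (hχle m x) h1.le (abs_nonneg _) zero_le_one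
        _ = η' := one_mul _
    · intro x hx
      rw [hχ0 m x hx, zero_mul]
    · calc η' * (σ (φ j)).real (Metric.closedBall 0 (m + 2)) ≤ η' * M (m + 2) :=
            mul_le_mul_of_nonneg_left (hM _ _) hη'0.le
        _ ≤ η' * (M (m + 2) + 1) := by gcongr; linarith
        _ = η := by rw [hη']; field_simp
  open CompactlySupported in
  choose L hL using fun f : C_c(EuclideanSpace ℝ (Fin n), ℝ) =>
    hconv f f.continuous f.hasCompactSupport
  let Λ : CompactlySupportedContinuousMap (EuclideanSpace ℝ (Fin n)) ℝ →ₚ[ℝ] ℝ :=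
    PositiveLinearMap.mk₀
      { toFun := L
        map_add' := fun f g => by
          refine tendsto_nhds_unique (hL (f + g)) (((hL f).add (hL g)).congr fun j => ?_)
          exact (integral_add f.integrable g.integrable).symm
        map_smul' := fun c f => by
          refine tendsto_nhds_unique (hL (c • f)) (((hL f).const_mul c).congr fun j => ?_)
          exact (integral_const_mul c _).symm }
      (fun f hf => ge_of_tendsto' (hL f) fun j => integral_nonneg hf)
  refine ⟨φ, hφ, RealRMK.rieszMeasure Λ, inferInstance, fun f hf hfs => ?_⟩
  have h1 := RealRMK.integral_rieszMeasure Λ ⟨⟨f, hf⟩, hfs⟩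
  have h2 := hL ⟨⟨f, hf⟩, hfs⟩
  change Tendsto _ _ (𝓝 (Λ ⟨⟨f, hf⟩, hfs⟩)) at h2
  rw [← h1] at h2
  exact h2

/-! ### Measures of balls under weak convergence -/

section Balls

variable {n : ℕ} {x : EuclideanSpace ℝ (Fin n)}

lemma ContDiffBump.measure_closedBall_le_ofReal_integral (χ : ContDiffBump x)
    (μ : Measure (EuclideanSpace ℝ (Fin n))) [IsFiniteMeasureOnCompacts μ] :
    μ (Metric.closedBall x χ.rIn) ≤ ENNReal.ofReal (∫ y, χ y ∂μ) := by
  rw [ofReal_integral_eq_lintegral_ofReal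
    (χ.continuous.integrable_of_hasCompactSupport χ.hasCompactSupport)
    (Eventually.of_forall fun _ => χ.nonneg),
    ← lintegral_indicator_one Metric.isClosed_closedBall.measurableSet]
  refine lintegral_mono fun y => ?_
  by_cases hy : y ∈ Metric.closedBall x χ.rIn
  · simp [hy, χ.one_of_mem_closedBall hy]
  · simp [hy]

lemma ContDiffBump.ofReal_integral_le_measure_ball (χ : ContDiffBump x)
    (μ : Measure (EuclideanSpace ℝ (Fin n))) [IsFiniteMeasureOnCompacts μ] :
    ENNReal.ofReal (∫ y, χ y ∂μ) ≤ μ (Metric.ball x χ.rOut) := by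
  rw [ofReal_integral_eq_lintegral_ofReal
    (χ.continuous.integrable_of_hasCompactSupport χ.hasCompactSupport)
    (Eventually.of_forall fun _ => χ.nonneg),
    ← lintegral_indicator_one Metric.isOpen_ball.measurableSet]
  refine lintegral_mono fun y => ?_
  by_cases hy : y ∈ Metric.ball x χ.rOut
  · simpa [hy] using χ.le_one
  · simp [hy, χ.zero_of_le_dist (not_lt.1 hy)]

variable {σ : ℕ → Measure (EuclideanSpace ℝ (Fin n))} {ν : Measure (EuclideanSpace ℝ (Fin n))}
  [∀ j, IsFiniteMeasureOnCompacts (σ j)] [IsFiniteMeasureOnCompacts ν] {s t : ℝ} {M : ENNReal}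

lemma WeaklyConverges.measure_closedBall_le (h : WeaklyConverges σ ν) (hs : 0 < s) (hst : s < t)
    (hM : ∀ᶠ j in atTop, σ j (Metric.ball x t) ≤ M) : ν (Metric.closedBall x s) ≤ M := by
  let χ : ContDiffBump x := ⟨s, t, hs, hst⟩
  refine (χ.measure_closedBall_le_ofReal_integral ν).trans (le_of_tendsto
    (ENNReal.tendsto_ofReal (h χ χ.continuous χ.hasCompactSupport)) ?_)
  filter_upwards [hM] with j hj using (χ.ofReal_integral_le_measure_ball _).trans hj

lemma WeaklyConverges.le_measure_ball (h : WeaklyConverges σ ν) (hs : 0 < s) (hst : s < t)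
    (hM : ∀ᶠ j in atTop, M ≤ σ j (Metric.closedBall x s)) : M ≤ ν (Metric.ball x t) := by
  let χ : ContDiffBump x := ⟨s, t, hs, hst⟩
  refine le_trans (ge_of_tendsto
    (ENNReal.tendsto_ofReal (h χ χ.continuous χ.hasCompactSupport)) ?_)
    (χ.ofReal_integral_le_measure_ball ν)
  filter_upwards [hM] with j hj using hj.trans (χ.measure_closedBall_le_ofReal_integral _)

lemma WeaklyConverges.upperGrowth {d A : ℝ} (h : WeaklyConverges σ ν)
    (hA : ∀ j, UpperGrowth d A (σ j)) : UpperGrowth d (A * 2 ^ d) ν := by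
  intro y r hr
  refine h.measure_closedBall_le hr (by linarith : r < 2 * r) (Eventually.of_forall fun j => ?_)
  refine (measure_mono Metric.ball_subset_closedBall).trans
    ((hA j y (2 * r) (by positivity)).trans_eq ?_)
  rw [Real.mul_rpow zero_le_two hr.le, mul_assoc]

end Balls

/-! ### Ahlfors regularity of the limit measure -/

section Ahlfors

variable {n : ℕ} {σ : ℕ → Measure (EuclideanSpace ℝ (Fin n))}
  {ν : Measure (EuclideanSpace ℝ (Fin n))}
  {E : ℕ → Set (EuclideanSpace ℝ (Fin n))} {F : Set (EuclideanSpace ℝ (Fin n))} {d C A : ℝ}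

lemma WeaklyConverges.measure_compl_eq_zero [∀ j, IsFiniteMeasureOnCompacts (σ j)]
    [IsFiniteMeasureOnCompacts ν] (h : WeaklyConverges σ ν)
    (hFc : IsClosed F) (hF : F.Nonempty)
    (hEF : ∀ x, Tendsto (fun j => Metric.infDist x (E j)) atTop (𝓝 (Metric.infDist x F)))
    (hσ : ∀ j, σ j (E j)ᶜ = 0) : ν Fᶜ = 0 := by
  refine measure_null_of_locally_null _ fun x hx => ?_
  have hpos := (hFc.notMem_iff_infDist_pos hF).1 hx
  set s := Metric.infDist x F
  refine ⟨Metric.closedBall x (s / 4), mem_nhdsWithin_of_mem_nhds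
    (Metric.closedBall_mem_nhds x (by positivity)), le_antisymm ?_ zero_le⟩
  refine h.measure_closedBall_le (by positivity) (by linarith : s / 4 < s / 2) ?_
  filter_upwards [(hEF x).eventually_const_lt (half_lt_self hpos)] with j hj
  refine (measure_mono_null (fun y hy hyE => ?_) (hσ j)).le
  rw [Metric.mem_ball'] at hy
  exact absurd (Metric.infDist_le_dist_of_mem hyE) (by linarith)

lemma WeaklyConverges.ofReal_le_measure_ball [∀ j, IsFiniteMeasureOnCompacts (σ j)]
    [IsFiniteMeasureOnCompacts ν] (h : WeaklyConverges σ ν)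
    (hEc : ∀ j, IsClosed (E j)) (hE : ∀ j, (E j).Nonempty)
    (hEF : ∀ x, Tendsto (fun j => Metric.infDist x (E j)) atTop (𝓝 (Metric.infDist x F)))
    (hd : ∀ r : ℝ, ∀ᶠ j in atTop, ENNReal.ofReal r < Metric.ediam (E j))
    (hσ : ∀ j, IsAhlforsRegular d C (E j) (σ j))
    {x : EuclideanSpace ℝ (Fin n)} (hx : x ∈ F) {r : ℝ} (hr : 0 < r) :
    ENNReal.ofReal (C⁻¹ * (r / 4) ^ d) ≤ ν (Metric.ball x r) := by
  refine h.le_measure_ball (by positivity) (half_lt_self hr) ?_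
  have hx0 := hEF x
  rw [Metric.infDist_zero_of_mem hx] at hx0
  filter_upwards [hd (r / 4), hx0.eventually_lt_const (by positivity : 0 < r / 4)] with j h1 h2
  obtain ⟨y, hy, hxy⟩ := (hEc j).exists_infDist_eq_dist (hE j) x
  refine ((hσ j).lower y hy _ (by positivity) h1).trans (measure_mono fun z hz => ?_)
  rw [Metric.mem_ball] at hz
  rw [Metric.mem_closedBall]
  have := dist_triangle z y x
  rw [dist_comm y x, ← hxy] at this
  linarith

/-- The lower bound at all scales forces an unbounded set, as closed balls have finite measure. -/
lemma not_isBounded_of_lower [IsFiniteMeasureOnCompacts ν] {c : ℝ} (hd : 0 < d)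
    (hc : 0 < c) (hF : F.Nonempty) (hν : ν Fᶜ = 0)
    (hlow : ∀ x ∈ F, ∀ r : ℝ, 0 < r → ENNReal.ofReal (c * r ^ d) ≤ ν (Metric.ball x r)) :
    ¬ Bornology.IsBounded F := by
  intro hb
  obtain ⟨x, hx⟩ := hF
  obtain ⟨R, hR⟩ := hb.subset_closedBall 0
  have hfin : ν Set.univ < ⊤ := by
    rw [← Set.union_compl_self F]
    refine (measure_union_le _ _).trans_lt ?_
    rw [hν, add_zero]
    exact (measure_mono hR).trans_lt (isCompact_closedBall _ _).measure_lt_top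
  have hlim : Tendsto (fun r : ℝ => ENNReal.ofReal (c * r ^ d)) atTop (𝓝 ⊤) :=
    ENNReal.tendsto_ofReal_atTop.comp ((tendsto_rpow_atTop hd).const_mul_atTop hc)
  refine absurd (le_of_tendsto hlim ?_) (not_le.2 hfin)
  filter_upwards [eventually_gt_atTop 0] with r hr
  exact (hlow x hx r hr).trans (measure_mono (Set.subset_univ _))

lemma isAhlforsRegular_of_bounds {c : ℝ} (hc : 0 < c) (hA : 0 < A) (hν : ν Fᶜ = 0)
    (hup : UpperGrowth d A ν)
    (hlow : ∀ x ∈ F, ∀ r : ℝ, 0 < r → ENNReal.ofReal (c * r ^ d) ≤ ν (Metric.ball x r)) :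
    IsAhlforsRegular d (c⁻¹ + A) F ν where
  const_pos := by positivity
  supported := hν
  lower x hx r hr _ := by
    refine (ENNReal.ofReal_le_ofReal ?_).trans (hlow x hx r hr)
    gcongr
    exact inv_le_of_inv_le₀ hc (by linarith)
  upper x _ r hr _ := by
    refine (measure_mono Metric.ball_subset_closedBall).trans ((hup x r hr).trans ?_)
    gcongr
    linarith [inv_pos.2 hc]

lemma support_eq_of_bounds {c : ℝ} (hc : 0 < c) (hFc : IsClosed F) (hν : ν Fᶜ = 0)
    (hlow : ∀ x ∈ F, ∀ r : ℝ, 0 < r → ENNReal.ofReal (c * r ^ d) ≤ ν (Metric.ball x r)) :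
    ν.support = F := by
  refine (Measure.support_subset_of_isClosed hFc hν).antisymm fun x hx => ?_
  refine (Measure.mem_support_iff_forall x).2 fun U hU => ?_
  obtain ⟨r, hr, hrU⟩ := Metric.mem_nhds_iff.1 hU
  exact (ENNReal.ofReal_pos.2 (by positivity)).trans_le
    ((hlow x hx r hr).trans (measure_mono hrU))

end Ahlfors

/-! ### The potentials behind the smooth distances -/

/-- The potential whose power `-1 / β` is the smooth distance. -/
noncomputable def potential {n : ℕ} (d β : ℝ) (E : Set (EuclideanSpace ℝ (Fin n)))
    (σ : Measure (EuclideanSpace ℝ (Fin n))) (y : EuclideanSpace ℝ (Fin n)) : ℝ :=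
  ∫ z in E, ‖y - z‖ ^ (-d - β) ∂σ

lemma measurable_norm_sub_rpow {n : ℕ} (p : ℝ) (y : EuclideanSpace ℝ (Fin n)) :
    Measurable fun z : EuclideanSpace ℝ (Fin n) => ‖y - z‖ ^ p :=
  (measurable_const.sub measurable_id).norm.pow_const p

/-- The bound `B R ^ (-β)` for the part of the potential outside balls of radius `R`. -/
def TailBound {n : ℕ} (d β B : ℝ) (σ : Measure (EuclideanSpace ℝ (Fin n))) : Prop :=
  ∀ y, ∀ R : ℝ, 0 < R →
    ∫⁻ z in (Metric.ball y R)ᶜ, ENNReal.ofReal (‖y - z‖ ^ (-d - β)) ∂σ ≤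
      ENNReal.ofReal (B * R ^ (-β))

/-- The kernel is integrated over dyadic annuli, which gives a geometric series. -/
lemma exists_tailBound (n : ℕ) {d β A : ℝ} (hβ : 0 < β) (hA : 0 < A) (hd : 0 < d) :
    ∃ B > 0, ∀ σ : Measure (EuclideanSpace ℝ (Fin n)), UpperGrowth d A σ →
      TailBound d β B σ := by
  set q : ℝ := 2 ^ (-β) with hq
  have hq0 : 0 < q := by positivity
  have hq1 : q < 1 := Real.rpow_lt_one_of_one_lt_of_neg one_lt_two (by linarith)
  have hq1' : 0 < 1 - q := by linarith
  refine ⟨A * 2 ^ d * (1 - q)⁻¹, by positivity, fun σ hσ y R hR => ?_⟩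
  have hcover : (Metric.ball y R)ᶜ ⊆
      ⋃ k : ℕ, Metric.closedBall y (2 * (2 ^ k * R)) \ Metric.ball y (2 ^ k * R) := by
    intro z hz
    have hz' : R ≤ dist z y := not_lt.1 hz
    obtain ⟨k, hk1, hk2⟩ := exists_nat_pow_near ((one_le_div hR).2 hz')
      (one_lt_two : (1 : ℝ) < 2)
    rw [le_div_iff₀ hR] at hk1
    rw [div_lt_iff₀ hR, pow_succ] at hk2
    refine Set.mem_iUnion.2 ⟨k, ?_, not_lt.2 hk1⟩
    rw [Metric.mem_closedBall]
    linarith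
  have hterm : ∀ k : ℕ,
      ∫⁻ z in Metric.closedBall y (2 * (2 ^ k * R)) \ Metric.ball y (2 ^ k * R),
        ENNReal.ofReal (‖y - z‖ ^ (-d - β)) ∂σ ≤
      ENNReal.ofReal (A * 2 ^ d * R ^ (-β) * q ^ k) := by
    intro k
    set s : ℝ := 2 ^ k * R with hs
    have hs0 : 0 < s := by positivity
    calc ∫⁻ z in Metric.closedBall y (2 * s) \ Metric.ball y s,
          ENNReal.ofReal (‖y - z‖ ^ (-d - β)) ∂σ
        ≤ ∫⁻ _z in Metric.closedBall y (2 * s) \ Metric.ball y s,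
          ENNReal.ofReal (s ^ (-d - β)) ∂σ := by
          refine setLIntegral_mono measurable_const fun z hz => ?_
          refine ENNReal.ofReal_le_ofReal (Real.rpow_le_rpow_of_nonpos hs0 ?_ (by linarith))
          rw [← dist_eq_norm, dist_comm]
          exact not_lt.1 hz.2
      _ = ENNReal.ofReal (s ^ (-d - β)) *
          σ (Metric.closedBall y (2 * s) \ Metric.ball y s) := setLIntegral_const _ _
      _ ≤ ENNReal.ofReal (s ^ (-d - β)) * ENNReal.ofReal (A * (2 * s) ^ d) := by
          gcongr
          exact (measure_mono Set.sdiff_subset).trans (hσ y _ (by positivity))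
      _ = ENNReal.ofReal (A * 2 ^ d * R ^ (-β) * q ^ k) := by
          rw [← ENNReal.ofReal_mul (by positivity)]
          congr 1
          have h1 : s ^ (-d - β) * s ^ d = s ^ (-β) := by
            rw [← Real.rpow_add hs0]; ring_nf
          have h2 : s ^ (-β) = q ^ k * R ^ (-β) := by
            rw [hs, Real.mul_rpow (by positivity) hR.le, hq, ← Real.rpow_natCast,
              ← Real.rpow_natCast, ← Real.rpow_mul zero_le_two, ← Real.rpow_mul zero_le_two,
              mul_comm (k : ℝ)]
          rw [Real.mul_rpow zero_le_two hs0.le]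
          calc s ^ (-d - β) * (A * (2 ^ d * s ^ d))
              = A * 2 ^ d * (s ^ (-d - β) * s ^ d) := by ring
            _ = A * 2 ^ d * R ^ (-β) * q ^ k := by rw [h1, h2]; ring
  calc ∫⁻ z in (Metric.ball y R)ᶜ, ENNReal.ofReal (‖y - z‖ ^ (-d - β)) ∂σ
      ≤ ∑' k : ℕ, ∫⁻ z in Metric.closedBall y (2 * (2 ^ k * R)) \ Metric.ball y (2 ^ k * R),
        ENNReal.ofReal (‖y - z‖ ^ (-d - β)) ∂σ :=
        (lintegral_mono_set hcover).trans (lintegral_iUnion_le _ _)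
    _ ≤ ∑' k : ℕ, ENNReal.ofReal (A * 2 ^ d * R ^ (-β) * q ^ k) :=
        ENNReal.tsum_le_tsum hterm
    _ = ENNReal.ofReal (A * 2 ^ d * (1 - q)⁻¹ * R ^ (-β)) := by
        rw [← ENNReal.ofReal_tsum_of_nonneg (fun k => by positivity)
          ((summable_geometric_of_lt_one hq0.le hq1).mul_left _), tsum_mul_left,
          tsum_geometric_of_lt_one hq0.le hq1]
        ring_nf

section Potential

variable {n : ℕ} {d β B c s R : ℝ} {E : Set (EuclideanSpace ℝ (Fin n))}
  {σ : Measure (EuclideanSpace ℝ (Fin n))} {x y : EuclideanSpace ℝ (Fin n)}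

lemma TailBound.integrableOn (h : TailBound d β B σ) (hR : 0 < R) :
    IntegrableOn (fun z => ‖y - z‖ ^ (-d - β)) (Metric.ball y R)ᶜ σ := by
  refine ⟨(measurable_norm_sub_rpow _ y).aestronglyMeasurable, ?_⟩
  rw [hasFiniteIntegral_iff_ofReal (Eventually.of_forall fun z => by positivity)]
  exact (h y R hR).trans_lt ENNReal.ofReal_lt_top

lemma TailBound.setIntegral_le (h : TailBound d β B σ) (hB : 0 ≤ B) (hR : 0 < R) :
    ∫ z in (Metric.ball y R)ᶜ, ‖y - z‖ ^ (-d - β) ∂σ ≤ B * R ^ (-β) := by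
  rw [integral_eq_lintegral_of_nonneg_ae (Eventually.of_forall fun z => by positivity)
    (measurable_norm_sub_rpow _ y).aestronglyMeasurable]
  exact ENNReal.toReal_le_of_le_ofReal (by positivity) (h y R hR)

lemma le_norm_sub_of_le_infDist {z : EuclideanSpace ℝ (Fin n)} (hs : s ≤ Metric.infDist y E)
    (hz : z ∈ E) : s ≤ ‖y - z‖ := by
  rw [← dist_eq_norm]
  exact hs.trans (Metric.infDist_le_dist_of_mem hz)

lemma TailBound.integrable (h : TailBound d β B σ) (hE : σ Eᶜ = 0) (hs0 : 0 < s)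
    (hs : s ≤ Metric.infDist y E) : Integrable (fun z => ‖y - z‖ ^ (-d - β)) σ := by
  have h1 := h.integrableOn (y := y) hs0
  rwa [IntegrableOn, Measure.restrict_eq_self_of_ae_mem] at h1
  filter_upwards [show ∀ᵐ z ∂σ, z ∈ E from hE] with z hz
  simpa [dist_comm, dist_eq_norm] using le_norm_sub_of_le_infDist hs hz

lemma potential_eq_integral (hE : σ Eᶜ = 0) :
    potential d β E σ y = ∫ z, ‖y - z‖ ^ (-d - β) ∂σ := by
  rw [potential, Measure.restrict_eq_self_of_ae_mem (show ∀ᵐ z ∂σ, z ∈ E from hE)]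

lemma potential_nonneg : 0 ≤ potential d β E σ y :=
  integral_nonneg fun z => by positivity

/-- The potential changes by a bounded factor when the point moves by a fraction of its distance
to the set. -/
lemma potential_le_mul (h : TailBound d β B σ) (hd : 0 < d) (hβ : 0 < β) (hE : σ Eᶜ = 0)
    (hs0 : 0 < s) (hx : s ≤ Metric.infDist x E) (hy : s ≤ Metric.infDist y E) :
    potential d β E σ y ≤ (1 + dist x y / s) ^ (d + β) * potential d β E σ x := by
  rw [potential_eq_integral hE, potential_eq_integral hE, ← integral_const_mul]
  refine integral_mono_ae (h.integrable hE hs0 hy) ((h.integrable hE hs0 hx).const_mul _) ?_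
  filter_upwards [show ∀ᵐ z ∂σ, z ∈ E from hE] with z hz
  have hxz := le_norm_sub_of_le_infDist hx hz
  have hyz := le_norm_sub_of_le_infDist hy hz
  have hτ : 0 ≤ dist x y / s := by positivity
  have h1 : ‖x - z‖ ≤ (1 + dist x y / s) * ‖y - z‖ := by
    have h2 : dist x y ≤ dist x y / s * ‖y - z‖ := by
      rw [div_mul_eq_mul_div, le_div_iff₀ hs0]
      gcongr
    have h3 := dist_triangle x y z
    rw [dist_eq_norm x z, dist_eq_norm y z] at h3
    linarith
  have h4 : ((1 + dist x y / s) * ‖y - z‖) ^ (-d - β) ≤ ‖x - z‖ ^ (-d - β) :=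
    Real.rpow_le_rpow_of_nonpos (hs0.trans_le hxz) h1 (by linarith)
  have hpos : 0 < 1 + dist x y / s := by positivity
  calc ‖y - z‖ ^ (-d - β)
      = (1 + dist x y / s) ^ (d + β) * ((1 + dist x y / s) * ‖y - z‖) ^ (-d - β) := by
        rw [Real.mul_rpow hpos.le (norm_nonneg _), ← mul_assoc, ← Real.rpow_add hpos,
          show d + β + (-d - β) = 0 by ring, Real.rpow_zero, one_mul]
    _ ≤ (1 + dist x y / s) ^ (d + β) * ‖x - z‖ ^ (-d - β) := by gcongr

lemma le_potential (h : TailBound d β B σ) (hd : 0 < d) (hβ : 0 < β)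
    (hE : σ Eᶜ = 0) (hEc : IsClosed E) (hEn : E.Nonempty)
    [IsFiniteMeasureOnCompacts σ] (hs0 : 0 < Metric.infDist y E)
    (hlow : ∀ x ∈ E, ENNReal.ofReal (c * Metric.infDist y E ^ d) ≤
      σ (Metric.ball x (Metric.infDist y E))) :
    c * 2 ^ (-d - β) * Metric.infDist y E ^ (-β) ≤ potential d β E σ y := by
  set s := Metric.infDist y E with hs
  obtain ⟨x, hx, hxy⟩ := hEc.exists_infDist_eq_dist hEn y
  have hint := h.integrable hE hs0 (le_refl s)
  have hfin : σ (E ∩ Metric.ball x s) ≠ ⊤ :=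
    ((measure_mono (Set.inter_subset_right.trans Metric.ball_subset_closedBall)).trans_lt
      (isCompact_closedBall x s).measure_lt_top).ne
  have hσ : c * s ^ d ≤ σ.real (E ∩ Metric.ball x s) := by
    refine (ENNReal.ofReal_le_iff_le_toReal hfin).1 ((hlow x hx).trans ?_)
    calc σ (Metric.ball x s) ≤ σ (E ∩ Metric.ball x s ∪ Eᶜ) := measure_mono fun z hz =>
          (em (z ∈ E)).imp (fun h => ⟨h, hz⟩) id
      _ ≤ σ (E ∩ Metric.ball x s) + σ Eᶜ := measure_union_le _ _
      _ = σ (E ∩ Metric.ball x s) := by rw [hE, add_zero]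
  have hk : ∀ z ∈ E ∩ Metric.ball x s, (2 * s) ^ (-d - β) ≤ ‖y - z‖ ^ (-d - β) := by
    intro z hz
    have h1 := le_norm_sub_of_le_infDist (le_refl s) hz.1
    refine Real.rpow_le_rpow_of_nonpos (hs0.trans_le h1) ?_ (by linarith)
    have h2 := dist_triangle y x z
    have h3 := Metric.mem_ball'.1 hz.2
    rw [dist_eq_norm y z] at h2
    linarith
  rw [potential_eq_integral hE]
  calc c * 2 ^ (-d - β) * s ^ (-β) = (2 * s) ^ (-d - β) * (c * s ^ d) := by
        rw [Real.mul_rpow zero_le_two hs0.le, show -β = (-d - β) + d by ring,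
          Real.rpow_add hs0]
        ring_nf
    _ ≤ (2 * s) ^ (-d - β) * σ.real (E ∩ Metric.ball x s) := by gcongr
    _ = ∫ _z in E ∩ Metric.ball x s, (2 * s) ^ (-d - β) ∂σ := by
        rw [setIntegral_const, smul_eq_mul, mul_comm]
    _ ≤ ∫ z in E ∩ Metric.ball x s, ‖y - z‖ ^ (-d - β) ∂σ :=
        setIntegral_mono_on (integrableOn_const hfin) hint.integrableOn
          (hEc.measurableSet.inter Metric.isOpen_ball.measurableSet) hk
    _ ≤ ∫ z, ‖y - z‖ ^ (-d - β) ∂σ :=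
        setIntegral_le_integral hint (Eventually.of_forall fun z => by positivity)

/-- Replacing the kernel by the compactly supported function `χ (max |x - z| s) ^ (-d - β)`, with
a cut-off `χ` that equals `1` on the ball of radius `R`, changes the potential by at most the
tail. -/
lemma abs_potential_sub_le (h : TailBound d β B σ) (hB : 0 ≤ B)
    (hE : σ Eᶜ = 0) (hs0 : 0 < s) (hx : s ≤ Metric.infDist x E) (χ : ContDiffBump x) :
    |potential d β E σ x - ∫ z, χ z * max ‖x - z‖ s ^ (-d - β) ∂σ| ≤ B * χ.rIn ^ (-β) := by
  have hint := h.integrable hE hs0 hx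
  have hχint : Integrable (fun z => χ z * ‖x - z‖ ^ (-d - β)) σ := by
    refine hint.mono ((χ.continuous.measurable.mul
      (measurable_norm_sub_rpow _ x)).aestronglyMeasurable) (Eventually.of_forall fun z => ?_)
    rw [norm_mul, Real.norm_of_nonneg χ.nonneg]
    exact mul_le_of_le_one_left (norm_nonneg _) χ.le_one
  have heq : ∫ z, χ z * max ‖x - z‖ s ^ (-d - β) ∂σ = ∫ z, χ z * ‖x - z‖ ^ (-d - β) ∂σ := by
    refine integral_congr_ae ?_
    filter_upwards [show ∀ᵐ z ∂σ, z ∈ E from hE] with z hz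
    rw [max_eq_left (le_norm_sub_of_le_infDist hx hz)]
  have hnn : ∀ z, 0 ≤ ‖x - z‖ ^ (-d - β) - χ z * ‖x - z‖ ^ (-d - β) := fun z =>
    sub_nonneg.2 (mul_le_of_le_one_left (by positivity) χ.le_one)
  rw [potential_eq_integral hE, heq, ← integral_sub hint hχint,
    abs_of_nonneg (integral_nonneg hnn)]
  refine le_trans ?_ (h.setIntegral_le (y := x) hB χ.rIn_pos)
  rw [← integral_indicator Metric.isOpen_ball.measurableSet.compl]
  refine integral_mono (hint.sub hχint)
    (hint.indicator Metric.isOpen_ball.measurableSet.compl) fun z => ?_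
  by_cases hz : z ∈ Metric.ball x χ.rIn
  · simp [hz, χ.one_of_mem_closedBall (Metric.ball_subset_closedBall hz)]
  · simp only [Set.mem_compl_iff, hz, not_false_eq_true, Set.indicator_of_mem]
    exact sub_le_self _ (mul_nonneg χ.nonneg (by positivity))

end Potential

/-! ### Convergence of potentials and smooth distances -/

section Convergence

variable {n : ℕ} {d β B : ℝ} {E : ℕ → Set (EuclideanSpace ℝ (Fin n))}
  {F : Set (EuclideanSpace ℝ (Fin n))}
  {σ : ℕ → Measure (EuclideanSpace ℝ (Fin n))} {ν : Measure (EuclideanSpace ℝ (Fin n))}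
  {x : EuclideanSpace ℝ (Fin n)}

lemma tendsto_potential (hβ : 0 < β) (hB : 0 ≤ B)
    (h : WeaklyConverges σ ν) (hσB : ∀ j, TailBound d β B (σ j)) (hνB : TailBound d β B ν)
    (hσE : ∀ j, σ j (E j)ᶜ = 0) (hνF : ν Fᶜ = 0)
    (hEF : Tendsto (fun j => Metric.infDist x (E j)) atTop (𝓝 (Metric.infDist x F)))
    (hx : 0 < Metric.infDist x F) :
    Tendsto (fun j => potential d β (E j) (σ j) x) atTop (𝓝 (potential d β F ν x)) := by
  set s := Metric.infDist x F / 2 with hs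
  have hs0 : 0 < s := by positivity
  have htail : Tendsto (fun R : ℝ => B * R ^ (-β)) atTop (𝓝 0) := by
    simpa using (tendsto_rpow_neg_atTop hβ).const_mul B
  rw [Metric.tendsto_nhds]
  intro η hη
  obtain ⟨R, hR0, hR⟩ := ((eventually_gt_atTop 0).and
    (htail.eventually_lt_const (by positivity : 0 < η / 3))).exists
  let χ : ContDiffBump x := ⟨R, 2 * R, hR0, by linarith⟩
  have hcont : Continuous fun z => χ z * max ‖x - z‖ s ^ (-d - β) := by
    refine χ.continuous.mul (Continuous.rpow_const (by fun_prop) fun z => .inl ?_)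
    exact (hs0.trans_le (le_max_right _ _)).ne'
  have h1 := Metric.tendsto_nhds.1 (h _ hcont χ.hasCompactSupport.mul_right) (η / 3)
    (by positivity)
  have h2 := abs_potential_sub_le hνB hB hνF hs0 (x := x) (by linarith : s ≤ _) χ
  filter_upwards [h1, hEF.eventually_const_lt (by linarith : s < _)] with j hj1 hj2
  have h3 := abs_potential_sub_le (hσB j) hB (hσE j) hs0 hj2.le χ
  rw [Real.dist_eq] at hj1 ⊢
  have hχR : χ.rIn = R := rfl
  rw [hχR] at h2 h3
  rw [abs_le] at h2 h3
  rw [abs_lt] at hj1 ⊢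
  constructor <;> linarith [h2.1, h2.2, h3.1, h3.2, hj1.1, hj1.2]

lemma eventually_prod_lt_infDist {a : ℝ} (ha : a < Metric.infDist x F)
    (hEF : Tendsto (fun j => Metric.infDist x (E j)) atTop (𝓝 (Metric.infDist x F))) :
    ∀ᶠ p : ℕ × EuclideanSpace ℝ (Fin n) in atTop ×ˢ 𝓝 x, a < Metric.infDist p.2 (E p.1) :=
  (tendsto_prod_of_lipschitz (fun _ => Metric.lipschitz_infDist_pt _) hEF).eventually_const_lt ha

lemma tendsto_potential_prod (hd : 0 < d) (hβ : 0 < β) (hB : 0 ≤ B)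
    (h : WeaklyConverges σ ν) (hσB : ∀ j, TailBound d β B (σ j)) (hνB : TailBound d β B ν)
    (hσE : ∀ j, σ j (E j)ᶜ = 0) (hνF : ν Fᶜ = 0)
    (hEF : Tendsto (fun j => Metric.infDist x (E j)) atTop (𝓝 (Metric.infDist x F)))
    (hx : 0 < Metric.infDist x F) :
    Tendsto (fun p : ℕ × EuclideanSpace ℝ (Fin n) => potential d β (E p.1) (σ p.1) p.2)
      (atTop ×ˢ 𝓝 x) (𝓝 (potential d β F ν x)) := by
  set s := Metric.infDist x F / 2 with hs
  have hs0 : 0 < s := by positivity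
  have hfix : Tendsto (fun p : ℕ × EuclideanSpace ℝ (Fin n) => potential d β (E p.1) (σ p.1) x)
      (atTop ×ˢ 𝓝 x) (𝓝 (potential d β F ν x)) :=
    (tendsto_potential hβ hB h hσB hνB hσE hνF hEF hx).comp tendsto_fst
  have hτ : Tendsto (fun p : ℕ × EuclideanSpace ℝ (Fin n) => (1 + dist x p.2 / s) ^ (d + β))
      (atTop ×ˢ 𝓝 x) (𝓝 1) := by
    have h1 : Tendsto (fun y : EuclideanSpace ℝ (Fin n) => (1 + dist x y / s) ^ (d + β)) (𝓝 x)
        (𝓝 ((1 + dist x x / s) ^ (d + β))) := by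
      refine Continuous.tendsto (Continuous.rpow_const (by fun_prop) fun y => .inr ?_) x
      linarith
    rw [dist_self, zero_div, add_zero, Real.one_rpow] at h1
    exact h1.comp tendsto_snd
  have hev1 := eventually_prod_lt_infDist (E := E) (by linarith : s < Metric.infDist x F) hEF
  have hev2 : ∀ᶠ p : ℕ × EuclideanSpace ℝ (Fin n) in atTop ×ˢ 𝓝 x,
      s < Metric.infDist x (E p.1) :=
    tendsto_fst.eventually (hEF.eventually_const_lt (by linarith : s < _))
  have hlo := hτ.inv₀ one_ne_zero |>.mul hfix
  have hhi := hτ.mul hfix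
  rw [inv_one, one_mul] at hlo
  rw [one_mul] at hhi
  refine tendsto_of_tendsto_of_tendsto_of_le_of_le' hlo hhi ?_ ?_
  · filter_upwards [hev1, hev2] with p h1 h2
    have h3 := potential_le_mul (hσB p.1) hd hβ (hσE p.1) hs0 h1.le h2.le
    rw [dist_comm] at h3
    rwa [inv_mul_le_iff₀ (by positivity)]
  · filter_upwards [hev1, hev2] with p h1 h2
    exact potential_le_mul (hσB p.1) hd hβ (hσE p.1) hs0 h2.le h1.le

end Convergence

section SmoothDist

variable {n : ℕ} {d β A B c : ℝ}

lemma smoothDist_of_notMem {Ω : Set (EuclideanSpace ℝ (Fin n))}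
    {σ : Measure (EuclideanSpace ℝ (Fin n))} {X : EuclideanSpace ℝ (Fin n)}
    (h : X ∉ frontier Ω) :
    smoothDist d β Ω σ X = potential d β (frontier Ω) σ X ^ (-(1 / β)) := if_neg h

lemma smoothDist_nonneg {Ω : Set (EuclideanSpace ℝ (Fin n))}
    {σ : Measure (EuclideanSpace ℝ (Fin n))} {X : EuclideanSpace ℝ (Fin n)} :
    0 ≤ smoothDist d β Ω σ X := by
  rw [smoothDist]
  split_ifs
  · exact le_rfl
  · exact Real.rpow_nonneg potential_nonneg _

lemma smoothDist_le {Ω : Set (EuclideanSpace ℝ (Fin n))}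
    {σ : Measure (EuclideanSpace ℝ (Fin n))} {y : EuclideanSpace ℝ (Fin n)}
    (h : TailBound d β B σ) (hd : 0 < d) (hβ : 0 < β) (hc : 0 < c)
    (hE : σ (frontier Ω)ᶜ = 0) (hne : (frontier Ω).Nonempty)
    [IsFiniteMeasureOnCompacts σ]
    (hlow : ∀ r : ℝ, 0 < r → r ≤ Metric.infDist y (frontier Ω) → ∀ x ∈ frontier Ω,
      ENNReal.ofReal (c * r ^ d) ≤ σ (Metric.ball x r)) :
    smoothDist d β Ω σ y ≤
      (c * 2 ^ (-d - β)) ^ (-(1 / β)) * Metric.infDist y (frontier Ω) := by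
  by_cases hy : y ∈ frontier Ω
  · rw [smoothDist, if_pos hy]
    exact mul_nonneg (by positivity) Metric.infDist_nonneg
  · have hs0 := (isClosed_frontier.notMem_iff_infDist_pos hne).1 hy
    have h1 := le_potential h hd hβ hE isClosed_frontier hne hs0 (hlow _ hs0 le_rfl)
    rw [smoothDist_of_notMem hy]
    refine (Real.rpow_le_rpow_of_nonpos (by positivity) h1 ?_).trans_eq ?_
    · exact neg_nonpos.2 (by positivity)
    · rw [Real.mul_rpow (by positivity) (by positivity), ← Real.rpow_mul hs0.le,
        show -β * -(1 / β) = 1 by field_simp, Real.rpow_one]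

/-- The smooth distances converge uniformly on compact sets. Away from the limit boundary this is
convergence of the potentials; near it all smooth distances are bounded by a multiple of the
distance to the boundary. -/
theorem tendstoUniformlyOn_smoothDist (hd : 0 < d) (hβ : 0 < β) (hc : 0 < c)
    (hA : 0 < A)
    {Ω : ℕ → Set (EuclideanSpace ℝ (Fin n))} {Ω' : Set (EuclideanSpace ℝ (Fin n))}
    {σ : ℕ → Measure (EuclideanSpace ℝ (Fin n))} {ν : Measure (EuclideanSpace ℝ (Fin n))}
    (h : WeaklyConverges σ ν) (hσA : ∀ j, UpperGrowth d A (σ j)) (hνA : UpperGrowth d A ν)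
    (hσE : ∀ j, σ j (frontier (Ω j))ᶜ = 0) (hνF : ν (frontier Ω')ᶜ = 0)
    (hne : ∀ j, (frontier (Ω j)).Nonempty) (hne' : (frontier Ω').Nonempty)
    (hEF : ∀ x, Tendsto (fun j => Metric.infDist x (frontier (Ω j))) atTop
      (𝓝 (Metric.infDist x (frontier Ω'))))
    (hσlow : ∀ R : ℝ, ∀ᶠ j in atTop, ∀ r : ℝ, 0 < r → r ≤ R → ∀ x ∈ frontier (Ω j),
      ENNReal.ofReal (c * r ^ d) ≤ σ j (Metric.ball x r))
    (hνlow : ∀ r : ℝ, 0 < r → ∀ x ∈ frontier Ω',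
      ENNReal.ofReal (c * r ^ d) ≤ ν (Metric.ball x r))
    {K : Set (EuclideanSpace ℝ (Fin n))} (hK : IsCompact K) :
    TendstoUniformlyOn (fun j => smoothDist d β (Ω j) (σ j)) (smoothDist d β Ω' ν) atTop K := by
  obtain ⟨B, hB0, hB⟩ := exists_tailBound n hβ hA hd
  have hσB : ∀ j, TailBound d β B (σ j) := fun j => hB _ (hσA j)
  have hνB : TailBound d β B ν := hB _ hνA
  have hσf : ∀ j, IsFiniteMeasureOnCompacts (σ j) := fun j => (hσA j).isFiniteMeasureOnCompacts
  have hνf := hνA.isFiniteMeasureOnCompacts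
  refine tendstoUniformlyOn_of_forall_tendsto_prod (fun x => ?_) hK
  by_cases hx : x ∈ frontier Ω'
  · rw [show smoothDist d β Ω' ν x = 0 from if_pos hx]
    have hδ := tendsto_prod_of_lipschitz (fun _ => Metric.lipschitz_infDist_pt _) (hEF x)
    rw [Metric.infDist_zero_of_mem hx] at hδ
    have hlim := hδ.const_mul ((c * 2 ^ (-d - β)) ^ (-(1 / β)))
    rw [mul_zero] at hlim
    refine squeeze_zero' (Eventually.of_forall fun p => smoothDist_nonneg) ?_ hlim
    filter_upwards [tendsto_fst.eventually (hσlow 1), hδ.eventually_lt_const one_pos]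
      with p h1 h2
    exact smoothDist_le (hσB p.1) hd hβ hc (hσE p.1) (hne p.1)
      fun r hr hrp => h1 r hr (hrp.trans h2.le)
  · have hpos := (isClosed_frontier.notMem_iff_infDist_pos hne').1 hx
    rw [smoothDist_of_notMem hx]
    have hpot : 0 < potential d β (frontier Ω') ν x :=
      lt_of_lt_of_le (by positivity) (le_potential hνB hd hβ hνF isClosed_frontier hne' hpos
        (hνlow _ hpos))
    have hlim := (tendsto_potential_prod hd hβ hB0.le h hσB hνB hσE hνF (hEF x) hpos).rpow_const
      (p := -(1 / β)) (.inl hpot.ne')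
    refine hlim.congr' ?_
    filter_upwards [eventually_prod_lt_infDist hpos (hEF x)] with p hp
    exact (smoothDist_of_notMem
      ((isClosed_frontier.notMem_iff_infDist_pos (hne p.1)).2 hp)).symm

end SmoothDist

/-! ### The compactness theorem -/

lemma eventually_ofReal_lt_ediam {n : ℕ} {E : ℕ → Set (EuclideanSpace ℝ (Fin n))}
    (hE : ∀ j, (2 : ENNReal) ^ j ≤ Metric.ediam (E j)) (r : ℝ) :
    ∀ᶠ j in atTop, ENNReal.ofReal r < Metric.ediam (E j) := by
  filter_upwards [(tendsto_pow_atTop_atTop_of_one_lt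
    (one_lt_two : (1 : ℝ) < 2)).eventually_gt_atTop r] with j hj
  refine lt_of_lt_of_le ?_ (hE j)
  rw [show (2 : ENNReal) ^ j = ENNReal.ofReal (2 ^ j) by
    rw [ENNReal.ofReal_pow zero_le_two, ENNReal.ofReal_ofNat]]
  exact (ENNReal.ofReal_lt_ofReal_iff (by positivity)).2 hj

theorem mainTheorem11 (n : ℕ) (d : ℝ) (hd : 0 < d) (hdn : d < n)
    (ε : ℝ) (N : ℕ) (C : ℝ)
    (Ω : ℕ → Set (EuclideanSpace ℝ (Fin n)))
    (σ : ℕ → Measure (EuclideanSpace ℝ (Fin n)))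
    (hunif : ∀ j, IsUniformDomain (Ω j) ε N)
    (hreg : ∀ j, IsAhlforsRegular d C (frontier (Ω j)) (σ j))
    (hdiam : ∀ j, (2 : ENNReal) ^ j ≤ Metric.ediam (frontier (Ω j)))
    (hzero : ∀ j, (0 : EuclideanSpace ℝ (Fin n)) ∈ frontier (Ω j)) :
    ∃ (φ : ℕ → ℕ) (Ωinf : Set (EuclideanSpace ℝ (Fin n)))
      (σinf : Measure (EuclideanSpace ℝ (Fin n))),
      StrictMono φ ∧
      (∀ x : EuclideanSpace ℝ (Fin n), ∀ r : ℝ, 0 < r →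
        Tendsto (fun j => localHausdorffDist x r (Ω (φ j)) Ωinf) atTop (𝓝 0) ∧
        Tendsto (fun j => localHausdorffDist x r (frontier (Ω (φ j))) (frontier Ωinf))
          atTop (𝓝 0)) ∧
      IsUniformDomain Ωinf (ε / 4) (10 * N) ∧
      WeaklyConverges (fun j => σ (φ j)) σinf ∧
      (∃ C' : ℝ, IsAhlforsRegular d C' (frontier Ωinf) σinf) ∧
      σinf.support = frontier Ωinf ∧
      ¬ Bornology.IsBounded σinf.support ∧
      ∀ β : ℝ, 0 < β → ∀ K : Set (EuclideanSpace ℝ (Fin n)), IsCompact K →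
        TendstoUniformlyOn (fun j => smoothDist d β (Ω (φ j)) (σ (φ j)))
          (smoothDist d β Ωinf σinf) atTop K := by
  have hε := (hunif 0).eps_pos
  have hε1 := (hunif 0).eps_lt_one
  have hC := (hreg 0).const_pos
  have hne : ∀ j, (frontier (Ω j)).Nonempty := fun j => ⟨0, hzero j⟩
  have hpos : ∀ j, 0 < Metric.ediam (frontier (Ω j)) := fun j =>
    lt_of_lt_of_le (by positivity) (hdiam j)
  -- Upper growth with one constant `A` for all the measures.
  obtain ⟨A, hA, hgrowth⟩ := exists_upperGrowth n hd hC
  have hσA : ∀ j, UpperGrowth d A (σ j) := fun j => hgrowth _ _ (hne j) (hpos j) (hreg j)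
  have hσf : ∀ j, IsFiniteMeasureOnCompacts (σ j) := fun j => (hσA j).isFiniteMeasureOnCompacts
  -- A first subsequence along which the distance functions converge.
  have h0 : ∀ j, Metric.infDist 0 (Ω j)ᶜ = 0 ∧ Metric.infDist 0 (Ω j) = 0 := by
    intro j
    have h1 := infDist_frontier_eq_add 0 (hne j)
    rw [Metric.infDist_zero_of_mem (hzero j)] at h1
    have h2 := Metric.infDist_nonneg (x := 0) (s := (Ω j)ᶜ)
    have h3 := Metric.infDist_nonneg (x := 0) (s := Ω j)
    constructor <;> linarith
  obtain ⟨φ₁, hφ₁, g, hg⟩ := exists_subseq_tendsto_infDist (0 : EuclideanSpace ℝ (Fin n))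
    (F := fun (b : Bool) j => if b then Ω j else (Ω j)ᶜ) (by
      rintro (_ | _) j
      · simpa using (h0 j).1
      · simpa using (h0 j).2)
  -- A further subsequence along which the measures converge.
  obtain ⟨φ₂, hφ₂, ν, hνf, hweak⟩ := exists_subseq_weaklyConverges (fun j => σ (φ₁ j))
    (fun R => A * max R 1 ^ d) (fun j R => by
      refine ENNReal.toReal_le_of_le_ofReal (by positivity) ?_
      exact (measure_mono (Metric.closedBall_subset_closedBall (le_max_left R 1))).trans
        (hσA (φ₁ j) 0 _ (by positivity)))
  set φ : ℕ → ℕ := fun j => φ₁ (φ₂ j) with hφdef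
  have hφ : StrictMono φ := hφ₁.comp hφ₂
  have hlim : DistLimit (fun j => Ω (φ j)) (g false) (g true) :=
    { isOpen := fun j => (hunif _).isDomain.1
      frontier_nonempty := fun j => hne _
      tendsto_compl := fun x => by
        simpa [Function.comp_def] using (hg false x).comp hφ₂.tendsto_atTop
      tendsto_self := fun x => by
        simpa [Function.comp_def] using (hg true x).comp hφ₂.tendsto_atTop }
  have hfd : ∀ r : ℝ, ∀ᶠ j in atTop, ENNReal.ofReal r < Metric.ediam (frontier (Ω (φ j))) :=
    fun r => hφ.tendsto_atTop.eventually (eventually_ofReal_lt_ediam hdiam r)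
  have hΩd : ∀ r : ℝ, ∀ᶠ j in atTop, ENNReal.ofReal r < Metric.ediam (Ω (φ j)) := by
    intro r
    filter_upwards [hfd r] with j hj
    rw [← Metric.ediam_closure]
    exact hj.trans_le (Metric.ediam_mono frontier_subset_closure)
  have hc : ∀ j, CorkscrewCondition (Ω (φ j)) ε := fun j => (hunif _).corkscrew
  set Ω' : Set (EuclideanSpace ℝ (Fin n)) := {x | 0 < g false x}
  have hself : ∀ x, Tendsto (fun j => Metric.infDist x (Ω (φ j))) atTop
      (𝓝 (Metric.infDist x Ω')) := fun x => by
    rw [← hlim.infDist_self hε hc hΩd]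
    exact hlim.tendsto_self x
  have hfront : ∀ x, Tendsto (fun j => Metric.infDist x (frontier (Ω (φ j)))) atTop
      (𝓝 (Metric.infDist x (frontier Ω'))) := fun x => by
    rw [← hlim.infDist_frontier hε hc hΩd]
    exact hlim.tendsto_frontier x
  have hne' : (frontier Ω').Nonempty := by
    rw [hlim.frontier_eq hε hc hΩd]
    exact (tendsto_infDist_eq_infDist_zero hlim.frontier_nonempty hlim.tendsto_frontier 0).1
  have hν : ν (frontier Ω')ᶜ = 0 := hweak.measure_compl_eq_zero isClosed_frontier hne' hfront
    fun j => (hreg _).supported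
  -- The factor `4⁻¹ ^ d` is what the limit measure loses; the constant `c` serves for it and for
  -- the measures of the sequence.
  set c : ℝ := C⁻¹ * 4⁻¹ ^ d with hcdef
  have hc0 : 0 < c := by positivity
  have hlow : ∀ r : ℝ, 0 < r → ∀ x ∈ frontier Ω',
      ENNReal.ofReal (c * r ^ d) ≤ ν (Metric.ball x r) := by
    intro r hr x hx
    refine le_of_eq_of_le ?_ (hweak.ofReal_le_measure_ball (fun j => isClosed_frontier)
      (fun j => hne _) hfront hfd (fun j => hreg _) hx hr)
    rw [hcdef, mul_assoc, ← Real.mul_rpow (by norm_num) hr.le, inv_mul_eq_div 4 r]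
  have hσlow : ∀ R : ℝ, ∀ᶠ j in atTop, ∀ r : ℝ, 0 < r → r ≤ R → ∀ x ∈ frontier (Ω (φ j)),
      ENNReal.ofReal (c * r ^ d) ≤ σ (φ j) (Metric.ball x r) := by
    intro R
    filter_upwards [hfd R] with j hj r hr hrR x hx
    refine le_trans (ENNReal.ofReal_le_ofReal ?_)
      ((hreg (φ j)).lower x hx r hr ((ENNReal.ofReal_le_ofReal hrR).trans_lt hj))
    gcongr
    exact mul_le_of_le_one_right (by positivity)
      (Real.rpow_le_one (by norm_num) (by norm_num) hd.le)
  have hνA : UpperGrowth d (A * 2 ^ d) ν := hweak.upperGrowth fun j => hσA _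
  have hA2 : A ≤ A * 2 ^ d :=
    le_mul_of_one_le_right hA.le (Real.one_le_rpow one_le_two hd.le)
  have hsupp : ν.support = frontier Ω' :=
    support_eq_of_bounds hc0 isClosed_frontier hν fun x hx r hr => hlow r hr x hx
  refine ⟨φ, Ω', ν, hφ, fun x r hr => ⟨tendsto_localHausdorffDist hself x hr,
    tendsto_localHausdorffDist hfront x hr⟩, ?_, hweak,
    ⟨c⁻¹ + A * 2 ^ d, ?_⟩, hsupp, ?_,
    fun β hβ K hK => ?_⟩
  · exact isUniformDomain_of_allScales hlim.isOpen_limit hε hε1 hne'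
      (hlim.corkscrewAllScales hε hc hΩd)
      (hlim.strictHarnack hε hc hΩd fun j => (hunif _).harnack)
  · exact isAhlforsRegular_of_bounds hc0 (by positivity) hν hνA fun x hx r hr => hlow r hr x hx
  · rw [hsupp]
    exact not_isBounded_of_lower hd hc0 hne' hν fun x hx r hr => hlow r hr x hx
  · refine tendstoUniformlyOn_smoothDist (A := A * 2 ^ d) hd hβ hc0 (by positivity) hweak
      (fun j y r hr => (hσA _ y r hr).trans (ENNReal.ofReal_le_ofReal ?_)) hνA
      (fun j => (hreg _).supported) hν (fun j => hne _) hne' hfront hσlow hlow hK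
    gcongr
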